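/- \textbf{Laminations.} A lamination $\mathcal L$ of dimension $n$ is a topological space with a (maximal) atlas of charts onto open subsets of a fixed product $\mathbb R^n\times\mathsf T$, $\mathsf T$ a topological space, whose transition homeomorphisms and their inverses locally map each card $O\times\{t\}$ ($O\subset\mathbb R^n$ open) into a card. For a chart $\phi$, an open connected $O\subset \mathbb R^n$, $S\subset\mathsf T$ open, $t\in \mathsf T$ and $x\in\mathbb R^n$, the sets $\phi^{-1}(O\times S)$, $\phi^{-1}(O\times\{t\})$, $\phi^{-1}(\{x\}\times S)$ are called flow boxes, plaques and open transversals. A leaf is a maximal union of overlapping plaques; it carries the topology generated by its plaques. A lamination map $F:\mathcal L\to\mathcal L'$ is a continuous map that maps every leaf into a leaf and such that for every $x\in\mathcal L$ there are open transversals $T\ni x$, $T'\ni F(x)$ with $F(T)\subset T'$. \textbf{Setting.} Let $\mathcal L$ be a Hausdorff, first countable lamination whose leaves are second countable (in the leaf topology), let $L\subset\mathcal L$ be a dense leaf and $p:\widetilde L\to L$ its universal cover. Assume that no plaque contained in $L$ is open in $\mathcal L$, or else that the fibres of $p$ are infinite (i.e. $\pi_1(L)$ is infinite). Let $\mathfrak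 U$ be an ultrafilter on $\mathbb N$ all of whose elements are infinite. A sequence $(\tilde x_\alpha)_{\alpha\in\mathbb N}$ in $\widetilde L$ is $\mathcal L$-convergent if $p(\tilde x_\alpha)$ converges in $\mathcal L$ to some $\hat x\in\mathcal L$. Two $\mathcal L$-convergent sequences $(\tilde x_\alpha)$, $(\tilde x'_\alpha)$ are $\mathcal L$-asymptotic if their projections have the same limit $\hat x$ and for every flow box $B$ about $\hat x$ there is $A\in\mathfrak U$ such that for all $\alpha\in A$ the points $\tilde x_\alpha,\tilde x'_\alpha$ lie in a common lift of a plaque of $B$ (a path component of its preimage under $p$). The germ universal cover ${}^{\bullet}\mathcal L$ is the set of asymptotic classes ${}^\bullet\tilde x$ of $\mathcal L$-convergent sequences, and the limit projection ${}^\bullet p:{}^{\bullet}\mathcal L\to\mathcal L$ sends a class to its limit $\hat x$. The leaf through ${}^\bullet\tilde x$ is the set of all ${}^\bullet\tilde y$ such that $\hat x={}^\bullet p({}^\bullet\tilde x)$ and $\hat y={}^\bullet p({}^\bullet\tilde y)$ lie in the same leaf of $\mathcal L$ and such that there are representatives $(\tilde x_\alpha)$, $(\tilde y_\alpha)$ and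 paths $\tilde\eta_\alpha$ in $\widetilde L$ from $\tilde x_\alpha$ to $\tilde y_\alpha$ for which the paths $p\circ\tilde\eta_\alpha$ converge (in the compact-open topology of paths in $\mathcal L$) to a path in $\mathcal L$ from $\hat x$ to $\hat y$. \textbf{Theorem.} ${}^{\bullet}\mathcal L$ can be given a topology and a structure of lamination of the same dimension $n$ (modelled on $\mathbb R^n\times \mathsf T'$ for some topological space $\mathsf T'$) such that the leaves of this lamination are exactly the leaves of ${}^{\bullet}\mathcal L$ defined above, every leaf is nowhere dense in ${}^{\bullet}\mathcal L$, and ${}^\bullet p:{}^{\bullet}\mathcal L\to\mathcal L$ is an open lamination map. -/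

import Mathlib

open Set Filter Topology

universe u v w

/-! ### Laminations -/

section Lamination

variable (n : ℕ) (T : Type v) [TopologicalSpace T]

/-- Continuous maps between open subsets of the deck of cards `ℝⁿ × T` which locally send cards
`O × {t}` into cards. -/
def laminationPregroupoid : Pregroupoid (EuclideanSpace ℝ (Fin n) × T) where
  property f s := ContinuousOn f s ∧
    ∀ a ∈ s, ∃ V ∈ 𝓝 a, ∀ b ∈ V ∩ s, ∀ c ∈ V ∩ s, b.2 = c.2 → (f b).2 = (f c).2
  comp := by
    rintro f g u v ⟨hf, hf'⟩ ⟨hg, hg'⟩ hu hv huv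
    refine ⟨hg.comp (hf.mono inter_subset_left) inter_subset_right, ?_⟩
    rintro a ⟨hau, hav⟩
    obtain ⟨V, hV, h1⟩ := hf' a hau
    obtain ⟨W, hW, h2⟩ := hg' (f a) hav
    have hc : ContinuousAt f a := hf.continuousAt (hu.mem_nhds hau)
    refine ⟨V ∩ f ⁻¹' W, inter_mem hV (hc hW), ?_⟩
    rintro b ⟨⟨hbV, hbW⟩, hbu, hbv⟩ c ⟨⟨hcV, hcW⟩, hcu, hcv⟩ hbc
    exact h2 _ ⟨hbW, hbv⟩ _ ⟨hcW, hcv⟩ (h1 b ⟨hbV, hbu⟩ c ⟨hcV, hcu⟩ hbc)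
  id_mem := ⟨continuousOn_id, fun a _ => ⟨univ, univ_mem, fun _ _ _ _ h => h⟩⟩
  locality := by
    intro f u hu h
    refine ⟨fun a ha => ?_, fun a ha => ?_⟩
    · obtain ⟨v, hv, hav, hc, -⟩ := h a ha
      exact (hc.continuousAt ((hu.inter hv).mem_nhds ⟨ha, hav⟩)).continuousWithinAt
    · obtain ⟨v, hv, hav, -, hc⟩ := h a ha
      obtain ⟨V, hV, h1⟩ := hc a ⟨ha, hav⟩
      refine ⟨V ∩ v, inter_mem hV (hv.mem_nhds hav), ?_⟩
      rintro b ⟨⟨hbV, hbv⟩, hbu⟩ c ⟨⟨hcV, hcv⟩, hcu⟩ hbc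
      exact h1 b ⟨hbV, hbu, hbv⟩ c ⟨hcV, hcu, hcv⟩ hbc
  congr := by
    rintro f g u hu hfg ⟨hc, h⟩
    refine ⟨hc.congr hfg, fun a ha => ?_⟩
    obtain ⟨V, hV, h1⟩ := h a ha
    refine ⟨V, hV, fun b hb c hcV hbc => ?_⟩
    rw [hfg b hb.2, hfg c hcV.2]
    exact h1 b hb c hcV hbc

/-- The transition homeomorphisms of laminations: homeomorphisms between open subsets of the
deck of cards `ℝⁿ × T` which, together with their inverses, locally send cards into cards. -/
def laminationGroupoid : StructureGroupoid (EuclideanSpace ℝ (Fin n) × T) :=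
  (laminationPregroupoid n T).groupoid

/-- `M`, with its atlas of charts into `ℝⁿ × T`, is a lamination of dimension `n`. -/
abbrev IsLamination (M : Type u) [TopologicalSpace M]
    [ChartedSpace (EuclideanSpace ℝ (Fin n) × T) M] : Prop :=
  HasGroupoid M (laminationGroupoid n T)

variable (M : Type u) [TopologicalSpace M] [ChartedSpace (EuclideanSpace ℝ (Fin n) × T) M]

/-- The data of an open flow box `φ⁻¹(O × S)` of `M`, with `O` open and connected in `ℝⁿ`,
`S` open in `T`, and `φ` a chart of the maximal atlas. -/
structure FlowBox where
  chart : OpenPartialHomeomorph M (EuclideanSpace ℝ (Fin n) × T)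
  chart_mem : chart ∈ (laminationGroupoid n T).maximalAtlas M
  base : Set (EuclideanSpace ℝ (Fin n))
  base_open : IsOpen base
  base_connected : IsConnected base
  trans : Set T
  trans_open : IsOpen trans
  subset_target : base ×ˢ trans ⊆ chart.target

variable {n T M}

/-- The flow box as a subset of `M`. -/
def FlowBox.carrier (B : FlowBox n T M) : Set M := B.chart.symm '' (B.base ×ˢ B.trans)

/-- The plaque of a flow box over `t`. -/
def FlowBox.plaque (B : FlowBox n T M) (t : T) : Set M := B.chart.symm '' (B.base ×ˢ {t})

variable (n T)

/-- Plaques: the subsets `φ⁻¹(O × {t})`, with `O` open and connected in `ℝⁿ`. -/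
def IsPlaque (P : Set M) : Prop :=
  ∃ φ ∈ (laminationGroupoid n T).maximalAtlas M,
    ∃ (O : Set (EuclideanSpace ℝ (Fin n))) (t : T),
      IsOpen O ∧ IsConnected O ∧ O ×ˢ {t} ⊆ φ.target ∧ P = φ.symm '' (O ×ˢ {t})

/-- Open transversals: the subsets `φ⁻¹({x} × S)`, with `S` open in `T`. -/
def IsOpenTransversal (A : Set M) : Prop :=
  ∃ φ ∈ (laminationGroupoid n T).maximalAtlas M,
    ∃ (x : EuclideanSpace ℝ (Fin n)) (S : Set T),
      IsOpen S ∧ {x} ×ˢ S ⊆ φ.target ∧ A = φ.symm '' ({x} ×ˢ S)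

/-- The leaf through `x`: the points that can be reached from `x` by a finite chain of overlapping
plaques. -/
def leaf (x : M) : Set M :=
  {y | Relation.ReflTransGen (fun a b : M => ∃ P : Set M, IsPlaque n T P ∧ a ∈ P ∧ b ∈ P) x y}

/-- The leaf through `x` as a space in its own right, to be given the leaf topology. -/
def LeafSpace (x : M) : Type u := {y : M // y ∈ leaf n T x}

variable {n T} in
/-- The inclusion of a leaf into the lamination. -/
def LeafSpace.incl {x : M} (y : LeafSpace n T x) : M := y.1

/-- The leaf topology, generated by the plaques (usually finer than the subspace topology). -/
instance (x : M) : TopologicalSpace (LeafSpace n T x) :=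
  TopologicalSpace.generateFrom {A | ∃ P : Set M, IsPlaque n T P ∧ A = LeafSpace.incl ⁻¹' P}

end Lamination

/-- A lamination map: a continuous map that sends each leaf into a leaf and, near each point, an
open transversal into an open transversal. -/
structure IsLaminationMap (n : ℕ) (T : Type*) [TopologicalSpace T]
    {M : Type*} [TopologicalSpace M] [ChartedSpace (EuclideanSpace ℝ (Fin n) × T) M]
    (n' : ℕ) (T' : Type*) [TopologicalSpace T']
    {M' : Type*} [TopologicalSpace M'] [ChartedSpace (EuclideanSpace ℝ (Fin n') × T') M']
    (F : M → M') : Prop where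
  continuous : Continuous F
  map_leaf : ∀ x : M, ∃ x' : M', F '' leaf n T x ⊆ leaf n' T' x'
  map_transversal : ∀ x : M, ∃ (A : Set M) (A' : Set M'),
    IsOpenTransversal n T A ∧ x ∈ A ∧ IsOpenTransversal n' T' A' ∧ F x ∈ A' ∧ F '' A ⊆ A'

/-! ### The germ universal cover -/

section GermUniversalCover

variable {n : ℕ} {T : Type v} [TopologicalSpace T]
  {M : Type u} [TopologicalSpace M] [ChartedSpace (EuclideanSpace ℝ (Fin n) × T) M]
  {x₀ : M} {X : Type w} [TopologicalSpace X] (p : X → LeafSpace n T x₀)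

/-- A sequence in the cover `X` of the leaf `L` through `x₀` whose projection converges, in the
topology of `M`, to a point of `M`; the limit is recorded (it is unique when `M` is Hausdorff). -/
structure LConvergentSeq where
  seq : ℕ → X
  lim : M
  tendsto : Tendsto (fun k => (p (seq k)).incl) atTop (𝓝 lim)

variable {p}

/-- Two convergent sequences are asymptotic if they have the same limit and, for every flow box `B`
about the limit and `U`-almost every index, their terms lie in a common lift (path component of the
preimage in `X`) of a plaque of `B`. -/
def IsAsymptotic (U : Ultrafilter ℕ) (s s' : LConvergentSeq p) : Prop :=
  s.lim = s'.lim ∧ ∀ B : FlowBox n T M, s.lim ∈ B.carrier →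
    ∀ᶠ k in (U : Filter ℕ), ∃ t ∈ B.trans,
      JoinedIn {z : X | (p z).incl ∈ B.plaque t} (s.seq k) (s'.seq k)

theorem FlowBox.isOpen_carrier (B : FlowBox n T M) : IsOpen B.carrier :=
  B.chart.isOpen_image_symm_of_subset_target (B.base_open.prod B.trans_open) B.subset_target

theorem FlowBox.plaque_inj (B : FlowBox n T M) {t t' : T} (ht : t ∈ B.trans) (ht' : t' ∈ B.trans)
    {y : M} (hy : y ∈ B.plaque t) (hy' : y ∈ B.plaque t') : t = t' := by
  obtain ⟨⟨a, b⟩, ⟨ha, hb⟩, rfl⟩ := hy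
  obtain ⟨⟨a', b'⟩, ⟨ha', hb'⟩, h⟩ := hy'
  simp only [mem_singleton_iff] at hb hb' ha ha'
  subst hb hb'
  have := B.chart.symm.injOn (B.subset_target ⟨ha', ht'⟩) (B.subset_target ⟨ha, ht⟩) h
  exact (congrArg Prod.snd this).symm

theorem isAsymptotic_equivalence (U : Ultrafilter ℕ) (hU : ∀ s ∈ U, s.Infinite) :
    Equivalence (IsAsymptotic U : LConvergentSeq p → LConvergentSeq p → Prop) where
  refl s := by
    refine ⟨rfl, fun B hB => ?_⟩
    have hle : (U : Filter ℕ) ≤ atTop := by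
      rw [← Nat.cofinite_eq_atTop]
      intro A hA
      by_contra hn
      exact hU _ (Ultrafilter.compl_mem_iff_notMem.2 hn) hA
    filter_upwards [hle (s.tendsto (B.isOpen_carrier.mem_nhds hB))] with k hk
    obtain ⟨⟨a, t⟩, ⟨ha, ht⟩, h⟩ := hk
    exact ⟨t, ht, JoinedIn.refl ⟨(a, t), ⟨ha, rfl⟩, h⟩⟩
  symm := by
    rintro s s' ⟨h, h'⟩
    refine ⟨h.symm, fun B hB => ?_⟩
    filter_upwards [h' B (h ▸ hB)] with k ⟨t, ht, hk⟩
    exact ⟨t, ht, hk.symm⟩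
  trans := by
    rintro s s' s'' ⟨h, h'⟩ ⟨g, g'⟩
    refine ⟨h.trans g, fun B hB => ?_⟩
    filter_upwards [h' B hB, g' B (h ▸ hB)] with k ⟨t, ht, hk⟩ ⟨t', ht', hk'⟩
    obtain rfl := B.plaque_inj ht ht' hk.target_mem hk'.source_mem
    exact ⟨t, ht, hk.trans hk'⟩

variable (p)

/-- The setoid of asymptotic convergent sequences. -/
def asymptoticSetoid (U : Ultrafilter ℕ) (hU : ∀ s ∈ U, s.Infinite) : Setoid (LConvergentSeq p) :=
  ⟨IsAsymptotic U, isAsymptotic_equivalence U hU⟩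

/-- The germ universal cover: the set of asymptotic classes of convergent sequences in `X`. -/
def GermUniversalCover (U : Ultrafilter ℕ) (hU : ∀ s ∈ U, s.Infinite) : Type (max u w) :=
  Quotient (asymptoticSetoid p U hU)

variable {p} {U : Ultrafilter ℕ} {hU : ∀ s ∈ U, s.Infinite}

/-- The asymptotic class of a convergent sequence. -/
def GermUniversalCover.mk (s : LConvergentSeq p) : GermUniversalCover p U hU :=
  Quotient.mk (asymptoticSetoid p U hU) s

/-- The limit projection of the germ universal cover to the lamination. -/
def GermUniversalCover.limProj (e : GermUniversalCover p U hU) : M :=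
  Quotient.lift (s := asymptoticSetoid p U hU) LConvergentSeq.lim (fun _ _ h => h.1) e

/-- The leaf through `e` in the germ universal cover: the classes `e'` whose limit lies in the same
leaf of `M` as that of `e`, and such that suitable representatives of `e` and `e'` are connected by
paths in `X` whose projections converge (in the compact-open topology of paths in `M`) to a path
connecting the limits. -/
def GermUniversalCover.leaf (e : GermUniversalCover p U hU) : Set (GermUniversalCover p U hU) :=
  {e' | _root_.leaf n T e.limProj = _root_.leaf n T e'.limProj ∧
    ∃ s s' : LConvergentSeq p, GermUniversalCover.mk s = e ∧ GermUniversalCover.mk s' = e' ∧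
      ∃ (η : ∀ k, Path (s.seq k) (s'.seq k)) (g : ℕ → C(unitInterval, M)) (γ : Path s.lim s'.lim),
        (∀ k r, g k r = (p (η k r)).incl) ∧ Tendsto g atTop (𝓝 γ.toContinuousMap)}

end GermUniversalCover

/-! ### Flow boxes, leaves and the leaf topology. -/

section FlowBoxes

variable {n : ℕ} {T : Type v} [TopologicalSpace T]
  {M : Type u} [TopologicalSpace M] [ChartedSpace (EuclideanSpace ℝ (Fin n) × T) M]

/-! Call two points of the germ universal cover related over a flow box if almost all terms of their
representatives lie in common lifts of plaques. The classes of this relation act as plaques.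
`PlaqueCover` records the few properties needed, and the lamination is built over any set `E` that
has them.

Basic open sets of `E` are preimages of open sets of `M` with countably many lifts of plaques
removed (`topology`, `isOpen_diff_countable`). Since whole lifts are removed, sliding along lifts is
continuous, and sliding to the centre of a box yields charts. Over each box a leaf of `E` consists
of countably many lifts, because the leaves of `M` are second countable
(`exists_countable_plaques`); it can therefore be removed, so it is closed. If the fibres of the
projection are uncountable, countably many lifts never exhaust a fibre. Hence a basic open set
projects onto the whole open set below it and is not contained in any leaf: the projection is open
and leaves are nowhere dense.

Fibres are uncountable by a diagonal argument (`not_countable_fiber`). It needs points near any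
given point of `M` that avoid finitely many lifts (`exists_not_liftRel`); this is where density of
the leaf and the alternative on open plaques or infinite fibres enter. Finally, the leaves defined
by convergent paths are the chains of lifts (`GermUniversalCover.leaf_eq_chain`): convergent paths
are cut into pieces inside flow boxes, and conversely points of a common lift are joined by segments
that are straight in coordinates. -/

theorem exists_nhds_card_compat [IsLamination n T M]
    {φ φ' : OpenPartialHomeomorph M (EuclideanSpace ℝ (Fin n) × T)}
    (hφ : φ ∈ (laminationGroupoid n T).maximalAtlas M)
    (hφ' : φ' ∈ (laminationGroupoid n T).maximalAtlas M) {y : M} (hy : y ∈ φ.source)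
    (hy' : y ∈ φ'.source) :
    ∃ N ∈ 𝓝 y, N ⊆ φ.source ∩ φ'.source ∧
      ∀ b ∈ N, ∀ c ∈ N, (φ b).2 = (φ c).2 → (φ' b).2 = (φ' c).2 := by
  have h := StructureGroupoid.compatible_of_mem_maximalAtlas hφ hφ'
  have h' := (mem_groupoid_of_pregroupoid.1 h).1.2 (φ y) (by
    simp [hy, hy'])
  obtain ⟨V, hV, hVc⟩ := h'
  refine ⟨(φ ⁻¹' V) ∩ (φ.source ∩ φ'.source), ?_, inter_subset_right, ?_⟩
  · exact inter_mem ((φ.continuousAt hy) hV)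
      ((φ.open_source.inter φ'.open_source).mem_nhds ⟨hy, hy'⟩)
  · rintro b ⟨hbV, hb, hb'⟩ c ⟨hcV, hc, hc'⟩ hbc
    have := hVc (φ b) ⟨hbV, by simp [hb, hb']⟩
      (φ c) ⟨hcV, by simp [hc, hc']⟩ hbc
    simpa [hb, hc] using this

namespace FlowBox

variable (B : FlowBox n T M)

/-- The point of a flow box with given coordinates. -/
def point (a : EuclideanSpace ℝ (Fin n)) (t : T) : M := B.chart.symm (a, t)

variable {B}

theorem mem_carrier_iff {y : M} : y ∈ B.carrier ↔
    y ∈ B.chart.source ∧ (B.chart y).1 ∈ B.base ∧ (B.chart y).2 ∈ B.trans := by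
  constructor
  · rintro ⟨q, hq, rfl⟩
    refine ⟨B.chart.map_target (B.subset_target hq), ?_⟩
    rw [B.chart.right_inv (B.subset_target hq)]
    exact hq
  · rintro ⟨h, h'⟩
    exact ⟨B.chart y, h', B.chart.left_inv h⟩

theorem mem_plaque_iff {y : M} {t : T} (ht : t ∈ B.trans) :
    y ∈ B.plaque t ↔ y ∈ B.carrier ∧ (B.chart y).2 = t := by
  constructor
  · rintro ⟨⟨a, s⟩, ⟨ha, hs⟩, rfl⟩
    obtain rfl : s = t := hs
    have hq : (a, s) ∈ B.base ×ˢ B.trans := ⟨ha, ht⟩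
    refine ⟨⟨_, hq, rfl⟩, ?_⟩
    rw [B.chart.right_inv (B.subset_target hq)]
  · rintro ⟨h, rfl⟩
    have h' := mem_carrier_iff.1 h
    exact ⟨B.chart y, ⟨h'.2.1, rfl⟩, B.chart.left_inv h'.1⟩

theorem chart_point {a : EuclideanSpace ℝ (Fin n)} {t : T} (ha : a ∈ B.base) (ht : t ∈ B.trans) :
    B.chart (B.point a t) = (a, t) :=
  B.chart.right_inv (B.subset_target ⟨ha, ht⟩)

theorem point_mem_carrier {a : EuclideanSpace ℝ (Fin n)} {t : T} (ha : a ∈ B.base)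
    (ht : t ∈ B.trans) : B.point a t ∈ B.carrier :=
  ⟨(a, t), ⟨ha, ht⟩, rfl⟩

theorem point_mem_plaque {a : EuclideanSpace ℝ (Fin n)} {t : T} (ha : a ∈ B.base) :
    B.point a t ∈ B.plaque t :=
  ⟨(a, t), ⟨ha, rfl⟩, rfl⟩

theorem point_chart {y : M} (hy : y ∈ B.carrier) :
    B.point (B.chart y).1 (B.chart y).2 = y :=
  B.chart.left_inv (mem_carrier_iff.1 hy).1

theorem chart_fst_mem {y : M} (hy : y ∈ B.carrier) : (B.chart y).1 ∈ B.base :=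
  (mem_carrier_iff.1 hy).2.1

theorem chart_snd_mem {y : M} (hy : y ∈ B.carrier) : (B.chart y).2 ∈ B.trans :=
  (mem_carrier_iff.1 hy).2.2

theorem continuousOn_point :
    ContinuousOn (fun q : EuclideanSpace ℝ (Fin n) × T => B.point q.1 q.2) (B.base ×ˢ B.trans) :=
  B.chart.continuousOn_symm.mono B.subset_target

theorem continuousOn_chart : ContinuousOn B.chart B.carrier :=
  B.chart.continuousOn.mono fun _ hy => (mem_carrier_iff.1 hy).1

theorem carrier_mem_nhds {y : M} (hy : y ∈ B.carrier) : B.carrier ∈ 𝓝 y :=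
  B.isOpen_carrier.mem_nhds hy

theorem plaque_subset_carrier {t : T} (ht : t ∈ B.trans) : B.plaque t ⊆ B.carrier :=
  fun _ hy => ((mem_plaque_iff ht).1 hy).1

theorem isPlaque_plaque {t : T} (ht : t ∈ B.trans) : IsPlaque n T (B.plaque t) :=
  ⟨B.chart, B.chart_mem, B.base, t, B.base_open, B.base_connected,
    fun q hq => B.subset_target ⟨hq.1, by rw [show q.2 = t from hq.2]; exact ht⟩, rfl⟩

theorem mem_leaf_of_snd_eq {y y' : M} (hy : y ∈ B.carrier) (hy' : y' ∈ B.carrier)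
    (h : (B.chart y).2 = (B.chart y').2) : y' ∈ leaf n T y :=
  Relation.ReflTransGen.single ⟨B.plaque (B.chart y).2, isPlaque_plaque (chart_snd_mem hy),
    (mem_plaque_iff (chart_snd_mem hy)).2 ⟨hy, rfl⟩,
    (mem_plaque_iff (chart_snd_mem hy)).2 ⟨hy', h.symm⟩⟩

/-- Keeping the chart `φ` lets a small box be compared with a larger one in the same coordinates. -/
theorem exists_convex_subset {φ : OpenPartialHomeomorph M (EuclideanSpace ℝ (Fin n) × T)}
    (hφ : φ ∈ (laminationGroupoid n T).maximalAtlas M) {y : M} (hy : y ∈ φ.source)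
    {V : Set M} (hV : V ∈ 𝓝 y) :
    ∃ B : FlowBox n T M, B.chart = φ ∧ Convex ℝ B.base ∧ y ∈ B.carrier ∧ B.carrier ⊆ V := by
  have h1 : φ.symm ⁻¹' V ∩ φ.target ∈ 𝓝 ((φ y).1, (φ y).2) := by
    refine inter_mem ?_ (φ.open_target.mem_nhds (φ.map_source hy))
    apply φ.symm.continuousAt (φ.map_source hy)
    rwa [φ.left_inv hy]
  obtain ⟨u, hu, s, hs, hus⟩ := mem_nhds_prod_iff.1 h1
  obtain ⟨ε, hε, hball⟩ := Metric.mem_nhds_iff.1 hu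
  obtain ⟨S, hSs, hS, hyS⟩ := mem_nhds_iff.1 hs
  have hsub : Metric.ball (φ y).1 ε ×ˢ S ⊆ φ.symm ⁻¹' V ∩ φ.target :=
    (prod_mono hball hSs).trans hus
  refine ⟨⟨φ, hφ, Metric.ball (φ y).1 ε, Metric.isOpen_ball,
    ⟨⟨_, Metric.mem_ball_self hε⟩, (convex_ball _ _).isPreconnected⟩, S, hS,
    fun q hq => (hsub hq).2⟩, rfl, convex_ball _ _, ?_, ?_⟩
  · exact ⟨φ y, ⟨Metric.mem_ball_self hε, hyS⟩, φ.left_inv hy⟩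
  · rintro _ ⟨q, hq, rfl⟩
    exact (hsub hq).1

theorem exists_convex_mem_nhds [IsLamination n T M] {y : M} {V : Set M} (hV : V ∈ 𝓝 y) :
    ∃ B : FlowBox n T M, Convex ℝ B.base ∧ y ∈ B.carrier ∧ B.carrier ⊆ V := by
  obtain ⟨B, -, h⟩ := exists_convex_subset
    ((laminationGroupoid n T).chart_mem_maximalAtlas y)
    (mem_chart_source (EuclideanSpace ℝ (Fin n) × T) y) hV
  exact ⟨B, h⟩

/-- `T` need not be T1, but `B.trans` injects continuously into the Hausdorff space `M` as a
transversal, where finite sets are closed. -/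
theorem finite_diff_open [T2Space M] {F : Set T} (hF : F.Finite) : IsOpen (B.trans \ F) := by
  obtain ⟨a, ha⟩ := B.base_connected.nonempty
  have hc : ContinuousOn (fun t => B.point a t) B.trans :=
    continuousOn_point.comp (f := fun t : T => (a, t)) (by fun_prop) fun t ht => ⟨ha, ht⟩
  have ho := hc.isOpen_inter_preimage B.trans_open
    ((hF.inter_of_right B.trans).image (fun t => B.point a t)).isClosed.isOpen_compl
  convert ho using 1
  ext t
  simp only [Set.mem_sdiff, mem_inter_iff, mem_preimage, mem_compl_iff, mem_image, not_exists, not_and]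
  refine and_congr_right fun ht => ⟨fun h s hs hst => h ?_, fun h htF => h t ⟨ht, htF⟩ rfl⟩
  have := congrArg (fun y => (B.chart y).2) hst
  simp only [chart_point ha ht, chart_point ha hs.1] at this
  exact this ▸ hs.2

end FlowBox

theorem leaf_symm {x y : M} (h : y ∈ leaf n T x) : x ∈ leaf n T y := by
  induction h with
  | refl => exact Relation.ReflTransGen.refl
  | tail _ hbc ih =>
    obtain ⟨P, hP, hb, hc⟩ := hbc
    exact Relation.ReflTransGen.head ⟨P, hP, hc, hb⟩ ih

theorem leaf_trans {x y z : M} (h : y ∈ leaf n T x) (h' : z ∈ leaf n T y) : z ∈ leaf n T x :=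
  Relation.ReflTransGen.trans h h'

theorem self_mem_leaf (x : M) : x ∈ leaf n T x := Relation.ReflTransGen.refl

theorem leaf_eq_of_mem {x y : M} (h : y ∈ leaf n T x) : leaf n T x = leaf n T y :=
  Subset.antisymm (fun _ hz => leaf_trans (leaf_symm h) hz) fun _ hz => leaf_trans h hz

theorem FlowBox.plaque_subset_leaf {B : FlowBox n T M} {x y : M} (hy : y ∈ leaf n T x)
    (hyB : y ∈ B.carrier) : B.plaque (B.chart y).2 ⊆ leaf n T x := by
  intro z hz
  have h := (mem_plaque_iff (chart_snd_mem hyB)).1 hz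
  exact leaf_trans hy (mem_leaf_of_snd_eq hyB h.1 h.2.symm)

theorem LeafSpace.isOpen_plaque {x : M} {P : Set M} (hP : IsPlaque n T P) :
    IsOpen (LeafSpace.incl (n := n) (T := T) (x := x) ⁻¹' P) :=
  TopologicalSpace.isOpen_generateFrom_of_mem ⟨P, hP, rfl⟩

variable [IsLamination n T M]

theorem LeafSpace.continuous_incl {x : M} :
    Continuous (LeafSpace.incl : LeafSpace n T x → M) := by
  refine continuous_def.2 fun V hV => isOpen_iff_mem_nhds.2 fun y hy => ?_
  obtain ⟨B, -, hyB, hBV⟩ := FlowBox.exists_convex_mem_nhds (n := n) (T := T) (hV.mem_nhds hy)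
  have ht := FlowBox.chart_snd_mem hyB
  filter_upwards [(isOpen_plaque (FlowBox.isPlaque_plaque ht)).mem_nhds
    ((FlowBox.mem_plaque_iff ht).2 ⟨hyB, rfl⟩ : y.incl ∈ _)] with z hz
  exact hBV (FlowBox.plaque_subset_carrier ht hz)

/-- A plaque from another chart meets this one in an open set of the card: near a common point the
other transversal coordinate is constant along the card, so only the condition on the `ℝⁿ`
coordinate remains. -/
theorem FlowBox.continuousOn_leafSpace {B : FlowBox n T M} {x : M} {t : T} (ht : t ∈ B.trans)
    {f : B.base → LeafSpace n T x} (hf : ∀ a, (f a).incl = B.point a t) : Continuous f := by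
  refine continuous_generateFrom_iff.2 ?_
  rintro _ ⟨P, ⟨φ, hφ, O, s, hO, -, hsub, rfl⟩, rfl⟩
  refine isOpen_iff_mem_nhds.2 fun a ha => ?_
  have hcont : Continuous fun b : B.base => B.point b t :=
    continuousOn_point.comp_continuous (f := fun b : B.base => ((b : EuclideanSpace ℝ (Fin n)), t))
      (by fun_prop) fun b => ⟨b.2, ht⟩
  rw [mem_preimage, mem_preimage, hf] at ha
  obtain ⟨⟨o, s'⟩, ⟨ho, hs'⟩, hq⟩ := ha
  obtain rfl : s' = s := hs'
  have htar : (o, s') ∈ φ.target := hsub ⟨ho, rfl⟩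
  have hsrc : B.point a t ∈ φ.source := hq ▸ φ.map_target htar
  have hφa : φ (B.point a t) = (o, s') := by rw [← hq, φ.right_inv htar]
  obtain ⟨N, hN, hNs, hNc⟩ := exists_nhds_card_compat B.chart_mem hφ
    (mem_carrier_iff.1 (point_mem_carrier a.2 ht)).1 hsrc
  have hO' : φ ⁻¹' (Prod.fst ⁻¹' O) ∈ 𝓝 (B.point a t) := by
    refine φ.continuousAt hsrc ((hO.preimage continuous_fst).mem_nhds ?_)
    rw [hφa]; exact ho
  filter_upwards [hcont.continuousAt (inter_mem hN hO')] with b hb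
  rw [mem_preimage, mem_preimage, hf]
  have h2 := hNc _ hb.1 _ (mem_of_mem_nhds hN) (by
    rw [chart_point b.2 ht, chart_point a.2 ht])
  refine ⟨φ (B.point b t), ⟨hb.2, ?_⟩, φ.left_inv (hNs hb.1).2⟩
  rw [mem_singleton_iff, h2, hφa]

end FlowBoxes

/-! ### Abstract covers by lifts of plaques, and their leaves. -/

/-- A set `E` over a lamination `M`, with a relation telling which points of `E` lie in a common
lift of a plaque, for a family of flow boxes that covers `M`. -/
structure PlaqueCover (n : ℕ) (T : Type v) [TopologicalSpace T] (M : Type u) [TopologicalSpace M]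
    [ChartedSpace (EuclideanSpace ℝ (Fin n) × T) M] (E : Type w) where
  /-- the chosen flow box about each point -/
  box : M → FlowBox n T M
  mem_box : ∀ y, y ∈ (box y).carrier
  /-- the projection -/
  proj : E → M
  /-- the relation of lying in a common lift of a plaque of the flow box -/
  rel : M → E → E → Prop
  rel_refl : ∀ y e, proj e ∈ (box y).carrier → rel y e e
  rel_symm : ∀ y e e', rel y e e' → rel y e' e
  rel_trans : ∀ y e e' e'', rel y e e' → rel y e' e'' → rel y e e''
  rel_mem : ∀ y e e', rel y e e' → proj e ∈ (box y).carrier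
  rel_plaque : ∀ y e e', rel y e e' → ((box y).chart (proj e)).2 = ((box y).chart (proj e')).2
  rel_ext : ∀ y e e', rel y e e' → proj e = proj e' → e = e'
  rel_lift : ∀ y e, proj e ∈ (box y).carrier → ∀ a ∈ (box y).base,
    ∃ e', rel y e e' ∧ proj e' = (box y).point a ((box y).chart (proj e)).2
  rel_local : ∀ y y' z, z ∈ (box y).carrier → z ∈ (box y').carrier →
    ∃ V ∈ 𝓝 z, ∀ e e', proj e ∈ V → proj e' ∈ V → rel y e e' → rel y' e e'

namespace PlaqueCover

variable {n : ℕ} {T : Type v} [TopologicalSpace T] {M : Type u} [TopologicalSpace M]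
  [ChartedSpace (EuclideanSpace ℝ (Fin n) × T) M] {E : Type w}

section Leaves

variable (c : PlaqueCover n T M E)

theorem rel_mem' {y : M} {e e' : E} (h : c.rel y e e') : c.proj e' ∈ (c.box y).carrier :=
  c.rel_mem _ _ _ (c.rel_symm _ _ _ h)

/-- The points reached from a point through a finite chain of overlapping lifts of plaques. -/
def chain (e : E) : Set E := {e' | Relation.ReflTransGen (fun a b => ∃ y, c.rel y a b) e e'}

variable {c}

theorem self_mem_chain (e : E) : e ∈ c.chain e := Relation.ReflTransGen.refl

theorem chain_trans {e e' e'' : E} (h : e' ∈ c.chain e) (h' : e'' ∈ c.chain e') :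
    e'' ∈ c.chain e :=
  Relation.ReflTransGen.trans h h'

theorem chain_symm {e e' : E} (h : e' ∈ c.chain e) : e ∈ c.chain e' := by
  induction h with
  | refl => exact Relation.ReflTransGen.refl
  | tail _ hbc ih =>
    obtain ⟨y, hy⟩ := hbc
    exact Relation.ReflTransGen.head ⟨y, c.rel_symm _ _ _ hy⟩ ih

theorem mem_chain_of_rel {y : M} {e e' : E} (h : c.rel y e e') : e' ∈ c.chain e :=
  Relation.ReflTransGen.single ⟨y, h⟩

theorem proj_mem_leaf {e e' : E} (h : e' ∈ c.chain e) : c.proj e' ∈ leaf n T (c.proj e) := by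
  induction h with
  | refl => exact self_mem_leaf _
  | tail _ hbc ih =>
    obtain ⟨y, hy⟩ := hbc
    exact leaf_trans ih (FlowBox.mem_leaf_of_snd_eq (c.rel_mem _ _ _ hy) (c.rel_mem' hy)
      (c.rel_plaque _ _ _ hy))

theorem rel_point {y : M} {e e' : E} (h : c.rel y e e') :
    (c.box y).point ((c.box y).chart (c.proj e')).1 ((c.box y).chart (c.proj e)).2 = c.proj e' := by
  rw [c.rel_plaque _ _ _ h]
  exact FlowBox.point_chart (c.rel_mem' h)

variable (c) in
open Classical in
/-- Transport of a point along the lift of a plaque through it. -/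
noncomputable def transport (y : M) (e : E) (a : EuclideanSpace ℝ (Fin n)) : E :=
  if h : ∃ e', c.rel y e e' ∧ c.proj e' = (c.box y).point a ((c.box y).chart (c.proj e)).2
  then h.choose else e

section Transport

variable {y : M} {e : E} {a : EuclideanSpace ℝ (Fin n)}

theorem rel_transport (he : c.proj e ∈ (c.box y).carrier) (ha : a ∈ (c.box y).base) :
    c.rel y e (c.transport y e a) := by
  have h := c.rel_lift y e he a ha
  rw [transport, dif_pos h]
  exact h.choose_spec.1

theorem proj_transport (he : c.proj e ∈ (c.box y).carrier) (ha : a ∈ (c.box y).base) :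
    c.proj (c.transport y e a) = (c.box y).point a ((c.box y).chart (c.proj e)).2 := by
  have h := c.rel_lift y e he a ha
  rw [transport, dif_pos h]
  exact h.choose_spec.2

theorem chart_proj_transport (he : c.proj e ∈ (c.box y).carrier) (ha : a ∈ (c.box y).base) :
    (c.box y).chart (c.proj (c.transport y e a)) = (a, ((c.box y).chart (c.proj e)).2) := by
  rw [proj_transport he ha, FlowBox.chart_point ha (FlowBox.chart_snd_mem he)]

theorem transport_eq_of_rel {e' : E} (h : c.rel y e e')
    (ha : ((c.box y).chart (c.proj e')).1 = a) : c.transport y e a = e' := by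
  have he := c.rel_mem _ _ _ h
  have ha' : a ∈ (c.box y).base := ha ▸ FlowBox.chart_fst_mem (c.rel_mem' h)
  refine c.rel_ext y _ _ (c.rel_trans _ _ _ _ (c.rel_symm _ _ _ (rel_transport he ha')) h) ?_
  rw [proj_transport he ha', ← ha, rel_point h]

theorem transport_congr {e' : E} (h : c.rel y e e') (ha : a ∈ (c.box y).base) :
    c.transport y e a = c.transport y e' a :=
  transport_eq_of_rel (c.rel_trans _ _ _ _ h (rel_transport (c.rel_mem' h) ha)) (by
    rw [chart_proj_transport (c.rel_mem' h) ha])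

theorem continuousOn_proj_transport (he : c.proj e ∈ (c.box y).carrier) :
    ContinuousOn (fun a => c.proj (c.transport y e a)) (c.box y).base := by
  have h : ContinuousOn (fun a => (c.box y).point a ((c.box y).chart (c.proj e)).2)
      (c.box y).base :=
    FlowBox.continuousOn_point.comp
      (f := fun a : EuclideanSpace ℝ (Fin n) => (a, ((c.box y).chart (c.proj e)).2))
      (by fun_prop) fun a ha => ⟨ha, FlowBox.chart_snd_mem he⟩
  exact h.congr fun a ha => proj_transport he ha

/-- A property that is locally invariant along the lifts of plaques of suitable flow boxes is
invariant along lifts of plaques. -/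
theorem rel_induction {P : E → Prop} {e e' : E} (h : c.rel y e e')
    (hP : ∀ f, c.rel y e f → ∃ y', c.proj f ∈ (c.box y').carrier ∧
      ∀ f', c.rel y' f f' → c.rel y e f' → (P f ↔ P f')) (he : P e) : P e' := by
  have hem := c.rel_mem _ _ _ h
  -- Transport parametrizes the lift by the connected base, so it suffices to compare nearby
  -- parameters, in both directions.
  have key := (c.box y).base_connected.isPreconnected.induction₂'
    (fun a b => P (c.transport y e a) → P (c.transport y e b)) (fun a ha => ?_)
    (fun _ _ _ _ _ _ h h' => h' ∘ h) (FlowBox.chart_fst_mem hem)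
    (FlowBox.chart_fst_mem (c.rel_mem' h))
  · rw [transport_eq_of_rel (c.rel_refl _ _ hem) rfl, transport_eq_of_rel h rfl] at key
    exact key he
  · have hr := rel_transport hem ha
    obtain ⟨y', hy', hyP⟩ := hP _ hr
    obtain ⟨V, hV, hloc⟩ := c.rel_local y y' _ (c.rel_mem' hr) hy'
    filter_upwards [(continuousOn_proj_transport hem a ha) hV, self_mem_nhdsWithin] with b hb hbB
    have hrb := rel_transport hem hbB
    have := hyP _ (hloc _ _ (mem_of_mem_nhds hV) hb
      (c.rel_trans _ _ _ _ (c.rel_symm _ _ _ hr) hrb)) hrb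
    exact ⟨this.1, this.2⟩

end Transport

/-- Countably many plaques and a countable dense set in the leaf below give countably many
itineraries from `e`. Their endpoints meet every lift in the chain, because a lift over one box
agrees locally with a lift over any other. -/
theorem exists_countable_plaques [IsLamination n T M]
    (hM : ∀ y : M, SecondCountableTopology (LeafSpace n T y)) (e : E) :
    ∃ R : Set E, R.Countable ∧ R ⊆ c.chain e ∧
      ∀ e' ∈ c.chain e, ∀ y, c.proj e' ∈ (c.box y).carrier → ∃ r ∈ R, c.rel y r e' := by
  let L := LeafSpace n T (c.proj e)
  have : SecondCountableTopology L := hM _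
  obtain ⟨D, hDc, hD⟩ := TopologicalSpace.exists_countable_dense L
  let W : L → Set L := fun l =>
    LeafSpace.incl ⁻¹' (c.box l.incl).plaque ((c.box l.incl).chart l.incl).2
  have hW : ∀ l, W l ∈ 𝓝 l := fun l =>
    (LeafSpace.isOpen_plaque (FlowBox.isPlaque_plaque
      (FlowBox.chart_snd_mem (c.mem_box _)))).mem_nhds
      ((FlowBox.mem_plaque_iff (FlowBox.chart_snd_mem (c.mem_box _))).2 ⟨c.mem_box _, rfl⟩)
  obtain ⟨J, hJc, hJ⟩ := TopologicalSpace.countable_cover_nhds hW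
  have hWp : ∀ {l l' : L}, l' ∈ W l ↔ l'.incl ∈ (c.box l.incl).carrier ∧
      ((c.box l.incl).chart l'.incl).2 = ((c.box l.incl).chart l.incl).2 := fun {l l'} =>
    FlowBox.mem_plaque_iff (FlowBox.chart_snd_mem (c.mem_box _))
  -- Each stage moves along lifts over the boxes of `J` to points over `D`. By `rel_ext` a triple
  -- `r, l, d` yields at most one new point, so every stage stays countable.
  let R : ℕ → Set E := fun k => Nat.rec {e}
    (fun _ S => ⋃ r ∈ S, ⋃ l ∈ J, ⋃ d ∈ D, {f | c.rel l.incl r f ∧ c.proj f = d.incl}) k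
  have hRs : ∀ k, R (k + 1) =
    ⋃ r ∈ R k, ⋃ l ∈ J, ⋃ d ∈ D, {f | c.rel l.incl r f ∧ c.proj f = d.incl} := fun _ => rfl
  have hRc : ∀ k, (R k).Countable := by
    intro k
    induction k with
    | zero => exact countable_singleton e
    | succ k ih =>
      rw [hRs]
      refine ih.biUnion fun r _ => hJc.biUnion fun l _ => hDc.biUnion fun d _ => ?_
      refine Set.Subsingleton.countable ?_
      rintro f ⟨hf, hfd⟩ f' ⟨hf', hfd'⟩
      exact c.rel_ext _ _ _ (c.rel_trans _ _ _ _ (c.rel_symm _ _ _ hf) hf') (hfd.trans hfd'.symm)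
  have hRchain : ∀ k, R k ⊆ c.chain e := by
    intro k
    induction k with
    | zero => exact singleton_subset_iff.2 (self_mem_chain e)
    | succ k ih =>
      rw [hRs]
      intro f hf
      simp only [mem_iUnion] at hf
      obtain ⟨r, hr, l, -, d, -, hrf, -⟩ := hf
      exact chain_trans (ih hr) (mem_chain_of_rel hrf)
  let P : E → Prop := fun f => ∀ y, c.proj f ∈ (c.box y).carrier → ∃ r ∈ ⋃ k, R k, c.rel y r f
  have hincl : Continuous (LeafSpace.incl : L → M) := LeafSpace.continuous_incl
  have hmk : ∀ f ∈ c.chain e, ∃ l : L, l.incl = c.proj f := fun f hf =>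
    ⟨⟨_, proj_mem_leaf hf⟩, rfl⟩
  -- Slide `f'` along its lift to a point over some `d ∈ D` so close that the relation over `l`
  -- implies the one over `y`; this point belongs to the next stage.
  have hstep : ∀ l ∈ J, ∀ f f', c.rel l.incl f f' → ∀ l' : L, l'.incl = c.proj f' →
      l' ∈ W l → P f → P f' := by
    intro l hlJ f f' hff' l' hl' hlW hPf y hy
    obtain ⟨r, hr, hrf⟩ := hPf l.incl (c.rel_mem _ _ _ hff')
    obtain ⟨V, hV, hloc⟩ := c.rel_local l.incl y _ (c.rel_mem' hff') hy
    have hopen := (interior_mem_nhds.2 (Filter.inter_mem (hincl.continuousAt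
      (x := l') (hl' ▸ hV)) ((LeafSpace.isOpen_plaque (FlowBox.isPlaque_plaque
      (FlowBox.chart_snd_mem (c.mem_box l.incl)))).mem_nhds hlW)))
    obtain ⟨d, hd, hdD⟩ := hD.inter_open_nonempty _ isOpen_interior ⟨_, mem_of_mem_nhds hopen⟩
    obtain ⟨hdV, hdW⟩ := interior_subset hd
    have hdW' := hWp.1 hdW
    have hrf' := c.rel_trans _ _ _ _ hrf hff'
    have hfm := c.rel_mem' hff'
    have hda := FlowBox.chart_fst_mem hdW'.1
    have htr := rel_transport (c := c) hfm hda
    have hproj : c.proj (c.transport l.incl f' ((c.box l.incl).chart d.incl).1) = d.incl := by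
      rw [proj_transport hfm hda]
      rw [← hl', (hWp.1 hlW).2, ← hdW'.2]
      exact FlowBox.point_chart hdW'.1
    refine ⟨_, ?_, hloc _ f' (by rw [hproj]; exact hdV) (mem_of_mem_nhds hV) (c.rel_symm _ _ _ htr)⟩
    obtain ⟨k, hk⟩ := mem_iUnion.1 hr
    refine mem_iUnion.2 ⟨k + 1, ?_⟩
    rw [hRs]
    simp only [mem_iUnion]
    exact ⟨r, hk, l, hlJ, d, hdD, c.rel_trans _ _ _ _ hrf' htr, hproj⟩
  refine ⟨⋃ k, R k, countable_iUnion hRc, iUnion_subset hRchain, fun e' he' => ?_⟩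
  change P e'
  induction he' with
  | refl => exact fun y hy => ⟨e, mem_iUnion.2 ⟨0, rfl⟩, c.rel_refl _ _ hy⟩
  | @tail f f' hf hff' ih =>
    obtain ⟨y, hy⟩ := hff'
    refine rel_induction hy (fun g hg => ?_) ih
    obtain ⟨lg, hlg⟩ := hmk g (chain_trans hf (mem_chain_of_rel hg))
    have hlJ : lg ∈ ⋃ l ∈ J, W l := hJ ▸ mem_univ _
    obtain ⟨l, hlJ, hlW⟩ := mem_iUnion₂.1 hlJ
    have hlW' := hWp.1 hlW
    rw [hlg] at hlW'
    refine ⟨l.incl, hlW'.1, fun g' hgg' hg' => ?_⟩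
    obtain ⟨lg', hlg'⟩ := hmk g' (chain_trans hf (mem_chain_of_rel hg'))
    refine ⟨hstep l hlJ _ _ hgg' lg' hlg' (hWp.2 ?_),
      hstep l hlJ _ _ (c.rel_symm _ _ _ hgg') lg hlg hlW⟩
    rw [hlg']
    exact ⟨c.rel_mem' hgg', (c.rel_plaque _ _ _ hgg').symm.trans hlW'.2⟩

end Leaves

end PlaqueCover
-- The topology with countably many lifts removed.
namespace PlaqueCover

variable {n : ℕ} {T : Type v} [TopologicalSpace T] {M : Type u} [TopologicalSpace M]
  [ChartedSpace (EuclideanSpace ℝ (Fin n) × T) M] {E : Type w}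

section Topology

variable (c : PlaqueCover n T M E)

/-- The topology whose basic open sets are the preimages of flow boxes with countably many lifts
of plaques removed. -/
@[reducible] def topology : TopologicalSpace E where
  IsOpen W := ∀ e ∈ W, ∀ y, c.proj e ∈ (c.box y).carrier →
    ∃ V ∈ 𝓝 (c.proj e), ∃ C : Set E, C.Countable ∧ (∀ x ∈ C, ¬ c.rel y e x) ∧
      ∀ e', c.proj e' ∈ V → (∀ x ∈ C, ¬ c.rel y e' x) → e' ∈ W
  isOpen_univ := fun _ _ _ _ => ⟨univ, univ_mem, ∅, countable_empty, by simp, fun _ _ _ => trivial⟩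
  isOpen_inter := by
    rintro W W' hW hW' e ⟨he, he'⟩ y hy
    obtain ⟨V, hV, C, hC, h1, h2⟩ := hW e he y hy
    obtain ⟨V', hV', C', hC', h1', h2'⟩ := hW' e he' y hy
    refine ⟨V ∩ V', inter_mem hV hV', C ∪ C', hC.union hC', ?_, fun e' heV hx => ⟨?_, ?_⟩⟩
    · rintro x (hx | hx)
      exacts [h1 x hx, h1' x hx]
    · exact h2 e' heV.1 fun x h => hx x (Or.inl h)
    · exact h2' e' heV.2 fun x h => hx x (Or.inr h)
  isOpen_sUnion := by
    rintro S hS e ⟨W, hWS, he⟩ y hy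
    obtain ⟨V, hV, C, hC, h1, h2⟩ := hS W hWS e he y hy
    exact ⟨V, hV, C, hC, h1, fun e' h h' => ⟨W, hWS, h2 e' h h'⟩⟩

/-- `E` carries the topology `c.topology`. -/
class HasPlaqueTopology [tE : TopologicalSpace E] : Prop where
  eq_topology : tE = c.topology

variable {c} [TopologicalSpace E] [hc : c.HasPlaqueTopology]

theorem isOpen_iff {W : Set E} : IsOpen W ↔
    ∀ e ∈ W, ∀ y, c.proj e ∈ (c.box y).carrier →
    ∃ V ∈ 𝓝 (c.proj e), ∃ C : Set E, C.Countable ∧ (∀ x ∈ C, ¬ c.rel y e x) ∧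
      ∀ e', c.proj e' ∈ V → (∀ x ∈ C, ¬ c.rel y e' x) → e' ∈ W := by
  rw [hc.eq_topology]; rfl

theorem continuous_proj : Continuous (c.proj : E → M) :=
  continuous_def.2 fun V hV => (isOpen_iff (c := c)).2 fun e he _ _ =>
    ⟨V, hV.mem_nhds he, ∅, countable_empty, by simp, fun _ h _ => h⟩

theorem isOpen_preimage_box (y : M) : IsOpen {e : E | c.proj e ∈ (c.box y).carrier} :=
  (c.box y).isOpen_carrier.preimage continuous_proj

/-- Openness is tested in every box about `e`, so the removed lifts must be re-expressed over a
second box `y'`, still as a countable family. -/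
theorem isOpen_diff_countable (y : M) {C : Set E} (hC : C.Countable) :
    IsOpen {e : E | c.proj e ∈ (c.box y).carrier ∧ ∀ x ∈ C, ¬ c.rel y e x} := by
  refine (isOpen_iff (c := c)).2 ?_
  rintro e ⟨he, hex⟩ y' hy'
  obtain ⟨V, hV, hloc⟩ := c.rel_local y y' _ he hy'
  obtain ⟨V', hV', hloc'⟩ := c.rel_local y' y _ hy' he
  let O := V ∩ V' ∩ (c.box y).carrier
  have hO : O ∈ 𝓝 (c.proj e) := inter_mem (inter_mem hV hV') (FlowBox.carrier_mem_nhds he)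
  -- Replace `x` by a point of its lift over `O`, where the relations over `y` and `y'` agree. Lifts
  -- that miss `O` play no role.
  have hch : ∀ x : E, ∃ x' : E, (∃ f, c.proj f ∈ O ∧ c.rel y f x) → c.proj x' ∈ O ∧ c.rel y x' x :=
    fun x => by
      by_cases h : ∃ f, c.proj f ∈ O ∧ c.rel y f x
      · exact ⟨h.choose, fun _ => h.choose_spec⟩
      · exact ⟨x, fun h' => absurd h' h⟩
  choose k hk using hch
  refine ⟨O, hO, k '' {x ∈ C | ∃ f, c.proj f ∈ O ∧ c.rel y f x},
    (hC.mono (sep_subset _ _)).image k, ?_, ?_⟩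
  · rintro _ ⟨x, ⟨hxC, hx⟩, rfl⟩ hr
    obtain ⟨h1, h2⟩ := hk x hx
    exact hex x hxC (c.rel_trans _ _ _ _
      (hloc' _ _ (mem_of_mem_nhds hO).1.2 h1.1.2 hr) h2)
  · intro e' he' hC'
    refine ⟨he'.2, fun x hxC hr => ?_⟩
    have hx : ∃ f, c.proj f ∈ O ∧ c.rel y f x := ⟨e', he', hr⟩
    obtain ⟨h1, h2⟩ := hk x hx
    exact hC' (k x) ⟨x, ⟨hxC, hx⟩, rfl⟩
      (hloc _ _ he'.1.1 h1.1.1 (c.rel_trans _ _ _ _ hr (c.rel_symm _ _ _ h2)))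

/-- Transport never leaves a lift, so avoiding the lifts through `C` is the same condition before
and after it; what remains is continuity of the projected motion in `M`. -/
theorem continuousOn_transport (y : M) :
    ContinuousOn (fun q : EuclideanSpace ℝ (Fin n) × E => (c.transport y q.2 q.1 : E))
      ((c.box y).base ×ˢ {e : E | c.proj e ∈ (c.box y).carrier}) := by
  rintro ⟨a, e⟩ ⟨ha, he⟩ s hs
  change a ∈ (c.box y).base at ha
  change c.proj e ∈ (c.box y).carrier at he
  change s ∈ 𝓝 (c.transport y e a) at hs
  obtain ⟨W, hWs, hW, hmem⟩ := mem_nhds_iff.1 hs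
  have hrel := rel_transport he ha
  obtain ⟨V, hV, C, hC, h1, h2⟩ := (isOpen_iff (c := c)).1 hW _ hmem y (c.rel_mem' hrel)
  have hp : ContinuousOn (fun q : EuclideanSpace ℝ (Fin n) × E =>
      (c.box y).point q.1 ((c.box y).chart (c.proj q.2)).2)
      ((c.box y).base ×ˢ {e : E | c.proj e ∈ (c.box y).carrier}) := by
    refine FlowBox.continuousOn_point.comp
      (f := fun q : EuclideanSpace ℝ (Fin n) × E =>
        (q.1, ((c.box y).chart (c.proj q.2)).2)) ?_
      fun q hq => ⟨hq.1, FlowBox.chart_snd_mem hq.2⟩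
    refine continuousOn_fst.prodMk (continuous_snd.comp_continuousOn ?_)
    exact FlowBox.continuousOn_chart.comp
      (continuous_proj.comp continuous_snd).continuousOn fun q hq => hq.2
  rw [proj_transport he ha] at hV
  have hV' := hp (a, e) ⟨ha, he⟩ hV
  have hG : ∀ᶠ q : EuclideanSpace ℝ (Fin n) × E in 𝓝 (a, e),
      ∀ x ∈ C, ¬ c.rel y q.2 x := by
    have ho := (isOpen_diff_countable (c := c) y hC).preimage
      (continuous_snd : Continuous (Prod.snd : EuclideanSpace ℝ (Fin n) × E → E))
    filter_upwards [ho.mem_nhds (show (a, e) ∈ _ from ⟨he, fun x hx hr =>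
      h1 x hx (c.rel_trans _ _ _ _ (c.rel_symm _ _ _ hrel) hr)⟩)] with q hq
    exact hq.2
  refine Filter.mem_map.2 ?_
  filter_upwards [hV', nhdsWithin_le_nhds hG, self_mem_nhdsWithin] with q hqV hqC hq
  refine hWs (h2 _ ?_ fun x hx hr => hqC x hx
    (c.rel_trans _ _ _ _ (rel_transport hq.2 hq.1) hr))
  rw [proj_transport hq.2 hq.1]
  exact hqV

end Topology

/-! ### The atlas of the cover. -/

section Charts

variable (c : PlaqueCover n T M E)

/-- The transversal space: the disjoint union, over all chosen flow boxes, of the points of `E` over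
the transversal through the centre of the flow box. -/
abbrev Transversal : Type (max u w) :=
  Σ y : M, {e : E // c.proj e ∈ (c.box y).carrier ∧
    ((c.box y).chart (c.proj e)).1 = ((c.box y).chart y).1}

variable {c}

theorem center_mem (y : M) : ((c.box y).chart y).1 ∈ (c.box y).base :=
  FlowBox.chart_fst_mem (c.mem_box y)

/-- The point of the central transversal on the same lift of a plaque. -/
noncomputable def toCenter (y : M) (e : {e : E | c.proj e ∈ (c.box y).carrier}) :
    c.Transversal :=
  ⟨y, c.transport y e.1 ((c.box y).chart y).1, c.rel_mem' (rel_transport e.2 (center_mem y)), by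
    rw [chart_proj_transport e.2 (center_mem y)]⟩

variable (c) in
open Classical in
/-- The transversal coordinate of the chart over a chosen flow box. -/
noncomputable def chartSnd (y : M) (e : E) : c.Transversal :=
  -- Off the chart domain the value is irrelevant; `e` lies on the central transversal of the box
  -- about its own projection.
  if h : c.proj e ∈ (c.box y).carrier then toCenter y ⟨e, h⟩ else ⟨c.proj e, e, c.mem_box _, rfl⟩

theorem chartSnd_of_mem {y : M} {e : E} (he : c.proj e ∈ (c.box y).carrier) :
    c.chartSnd y e = toCenter y ⟨e, he⟩ := dif_pos he

variable [TopologicalSpace E] [hc : c.HasPlaqueTopology]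

theorem continuous_toCenter (y : M) : Continuous (toCenter (c := c) y) := by
  refine continuous_sigmaMk.comp (Continuous.subtype_mk ?_ _)
  exact (continuousOn_transport y).comp_continuous
    (f := fun e : {e : E | c.proj e ∈ (c.box y).carrier} => (((c.box y).chart y).1, e.1))
    (by fun_prop) fun e => ⟨center_mem y, e.2⟩

variable (c) in
/-- The chart of `E` over a chosen flow box. -/
noncomputable def chart (y : M) :
    OpenPartialHomeomorph E (EuclideanSpace ℝ (Fin n) × c.Transversal) where
  toFun e := (((c.box y).chart (c.proj e)).1, c.chartSnd y e)
  invFun q := c.transport y q.2.2.1 q.1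
  source := {e | c.proj e ∈ (c.box y).carrier}
  target := (c.box y).base ×ˢ range (Sigma.mk y)
  map_source' e he := by
    refine ⟨FlowBox.chart_fst_mem he, ?_⟩
    exact ⟨_, (chartSnd_of_mem he).symm⟩
  map_target' := by
    rintro ⟨a, _⟩ ⟨ha, ⟨e, rfl⟩⟩
    exact c.rel_mem' (rel_transport e.2.1 ha)
  left_inv' e he := by
    rw [chartSnd_of_mem he]
    exact transport_eq_of_rel (c.rel_symm _ _ _ (rel_transport he (center_mem y))) rfl
  right_inv' := by
    rintro ⟨a, _⟩ ⟨ha, ⟨e, rfl⟩⟩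
    have hr := rel_transport e.2.1 ha
    refine Prod.ext ?_ ?_
    · change ((c.box y).chart (c.proj (c.transport y e.1 a))).1 = a
      rw [chart_proj_transport e.2.1 ha]
    · refine (chartSnd_of_mem (c.rel_mem' hr)).trans ?_
      refine congrArg (Sigma.mk y) (Subtype.ext ?_)
      exact transport_eq_of_rel (c.rel_symm _ _ _ hr) e.2.2
  open_source := isOpen_preimage_box y
  open_target := (c.box y).base_open.prod isOpen_range_sigmaMk
  continuousOn_toFun := by
    refine ContinuousOn.prodMk ?_ ?_
    · exact continuous_fst.comp_continuousOn
        (FlowBox.continuousOn_chart.comp continuous_proj.continuousOn fun _ h => h)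
    · rw [continuousOn_iff_continuous_domRestrict]
      refine (continuous_toCenter y).congr fun e => ?_
      exact (chartSnd_of_mem e.2).symm
  continuousOn_invFun := by
    refine (continuousOn_transport y).comp
      (f := fun q : EuclideanSpace ℝ (Fin n) × c.Transversal => (q.1, (q.2.2.1 : E))) ?_ ?_
    · exact (continuous_fst.prodMk ((continuous_sigma fun _ =>
        continuous_subtype_val : Continuous fun τ : c.Transversal => (τ.2.1 : E)).comp continuous_snd)).continuousOn
    · rintro ⟨a, _⟩ ⟨ha, ⟨e, rfl⟩⟩
      exact ⟨ha, e.2.1⟩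

theorem mem_chart_source_iff {y : M} {e : E} :
    e ∈ (c.chart y).source ↔ c.proj e ∈ (c.box y).carrier := Iff.rfl

theorem chart_snd {y : M} {e : E} (he : c.proj e ∈ (c.box y).carrier) :
    (c.chart y e).2 = toCenter y ⟨e, he⟩ := chartSnd_of_mem he

/-- Cards of the new charts are exactly lifts of plaques, which turns `rel_local` into compatibility
of charts. -/
theorem chart_snd_eq_iff {y : M} {e e' : E} (he : c.proj e ∈ (c.box y).carrier)
    (he' : c.proj e' ∈ (c.box y).carrier) :
    (c.chart y e).2 = (c.chart y e').2 ↔ c.rel y e e' := by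
  rw [chart_snd he, chart_snd he']
  constructor
  · intro h
    have h' : c.transport y e ((c.box y).chart y).1 = c.transport y e' ((c.box y).chart y).1 :=
      congrArg (fun τ : c.Transversal => (τ.2.1 : E)) h
    have h1 := rel_transport he (center_mem y)
    rw [h'] at h1
    exact c.rel_trans _ _ _ _ h1 (c.rel_symm _ _ _ (rel_transport he' (center_mem y)))
  · intro h
    exact congrArg (Sigma.mk y) (Subtype.ext (transport_congr h (center_mem y)))

variable (c) in
/-- The atlas of `E` over the chosen flow boxes. -/
@[reducible] noncomputable def chartedSpace :
    ChartedSpace (EuclideanSpace ℝ (Fin n) × c.Transversal) E where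
  atlas := range c.chart
  chartAt e := c.chart (c.proj e)
  mem_chart_source e := c.mem_box (c.proj e)
  chart_mem_atlas _ := ⟨_, rfl⟩

theorem isLamination : @IsLamination n c.Transversal _ E _ c.chartedSpace := by
  let _ := c.chartedSpace
  refine hasGroupoid_of_pregroupoid _ ?_
  rintro _ _ ⟨y, rfl⟩ ⟨y', rfl⟩
  refine ⟨((c.chart y).symm.trans (c.chart y')).continuousOn, fun q hq => ?_⟩
  have hq' : q ∈ (c.chart y).target ∧ (c.chart y).symm q ∈ (c.chart y').source := by
    simpa using hq
  obtain ⟨V, hV, hloc⟩ := c.rel_local y y' _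
    (mem_chart_source_iff.1 ((c.chart y).map_target hq'.1)) (mem_chart_source_iff.1 hq'.2)
  refine ⟨_, ((c.chart y).symm.continuousAt hq'.1) (continuous_proj.continuousAt hV), ?_⟩
  rintro b ⟨hbV, hb⟩ d ⟨hdV, hd⟩ hbd
  have hb' : b ∈ (c.chart y).target ∧ (c.chart y).symm b ∈ (c.chart y').source := by
    simpa using hb
  have hd' : d ∈ (c.chart y).target ∧ (c.chart y).symm d ∈ (c.chart y').source := by
    simpa using hd
  refine (chart_snd_eq_iff hb'.2 hd'.2).2 (hloc _ _ hbV hdV ?_)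
  refine (chart_snd_eq_iff ((c.chart y).map_target hb'.1) ((c.chart y).map_target hd'.1)).1 ?_
  rw [(c.chart y).right_inv hb'.1, (c.chart y).right_inv hd'.1, hbd]

end Charts

end PlaqueCover
-- Closed leaves, nowhere density and openness of the projection.
namespace PlaqueCover

section Consequences

variable {n : ℕ} {T : Type v} [TopologicalSpace T] {M : Type u} [TopologicalSpace M]
  [ChartedSpace (EuclideanSpace ℝ (Fin n) × T) M] {E : Type w} {c : PlaqueCover n T M E}

/-- A lift has at most one point over `z`, so countably many lifts cannot cover an uncountable
fibre. -/
theorem exists_proj_eq_not_rel (hfib : ∀ z, ¬ (c.proj ⁻¹' {z}).Countable) (y z : M) {C : Set E}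
    (hC : C.Countable) : ∃ e, c.proj e = z ∧ ∀ x ∈ C, ¬ c.rel y e x := by
  by_contra! h
  refine hfib z ((hC.biUnion (t := fun x _ => {e | c.proj e = z ∧ c.rel y e x})
    fun x _ => Set.Subsingleton.countable ?_).mono ?_)
  · rintro e ⟨he, hex⟩ e' ⟨he', hex'⟩
    exact c.rel_ext y _ _ (c.rel_trans _ _ _ _ hex (c.rel_symm _ _ _ hex')) (he.trans he'.symm)
  · intro e he
    obtain ⟨x, hx, hr⟩ := h e he
    exact mem_biUnion hx ⟨he, hr⟩

variable [TopologicalSpace E] [hc : c.HasPlaqueTopology]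

theorem isOpenMap_proj (hfib : ∀ z, ¬ (c.proj ⁻¹' {z}).Countable) : IsOpenMap c.proj := by
  intro W hW
  refine isOpen_iff_mem_nhds.2 ?_
  rintro _ ⟨e, he, rfl⟩
  obtain ⟨V, hV, C, hC, -, h⟩ := (isOpen_iff (c := c)).1 hW e he _ (c.mem_box _)
  filter_upwards [hV] with z hz
  obtain ⟨e', rfl, he'⟩ := exists_proj_eq_not_rel hfib (c.proj e) z hC
  exact ⟨e', h e' hz he', rfl⟩

theorem isClosed_chain [IsLamination n T M]
    (hM : ∀ y : M, SecondCountableTopology (LeafSpace n T y)) (e : E) : IsClosed (c.chain e) := by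
  refine ⟨(isOpen_iff (c := c)).2 fun f hf y hy => ?_⟩
  obtain ⟨R, hRc, hRe, hR⟩ := exists_countable_plaques (c := c) hM e
  refine ⟨_, FlowBox.carrier_mem_nhds hy, R, hRc, fun x hx hr => hf ?_, fun f' hf' h hfe => ?_⟩
  · exact chain_trans (hRe hx) (chain_symm (mem_chain_of_rel hr))
  · obtain ⟨r, hr, hrf⟩ := hR f' hfe y hf'
    exact h r hr (c.rel_symm _ _ _ hrf)

theorem isNowhereDense_chain [IsLamination n T M]
    (hM : ∀ y : M, SecondCountableTopology (LeafSpace n T y))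
    (hfib : ∀ z, ¬ (c.proj ⁻¹' {z}).Countable) (e : E) : IsNowhereDense (c.chain e) := by
  refine (isClosed_chain hM e).isNowhereDense_iff.2 (eq_empty_iff_forall_notMem.2 fun f hf => ?_)
  obtain ⟨V, hV, C, hC, -, h⟩ :=
    (isOpen_iff (c := c)).1 isOpen_interior f hf _ (c.mem_box _)
  obtain ⟨R, hRc, -, hR⟩ := exists_countable_plaques (c := c) hM e
  -- Avoiding `C` keeps `f'` inside the interior of the leaf, while avoiding `R` keeps it off the
  -- leaf.
  obtain ⟨f', hf', hfx⟩ := exists_proj_eq_not_rel hfib (c.proj f) (c.proj f) (hC.union hRc)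
  have hfe := interior_subset (h f' (hf' ▸ mem_of_mem_nhds hV) fun x hx => hfx x (Or.inl hx))
  obtain ⟨r, hr, hrf⟩ := hR f' hfe (c.proj f) (hf' ▸ c.mem_box _)
  exact hfx r (Or.inr hr) (c.rel_symm _ _ _ hrf)

theorem leaf_eq_chain (e : E) :
    @leaf n c.Transversal _ E _ c.chartedSpace e = c.chain e := by
  let _ := c.chartedSpace
  have := c.isLamination
  have hchart : ∀ y, c.chart y ∈ (laminationGroupoid n c.Transversal).maximalAtlas E := fun y =>
    StructureGroupoid.subset_maximalAtlas _ ⟨y, rfl⟩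
  refine Subset.antisymm (fun e' he' => ?_) (fun e' he' => ?_)
  · induction he' with
    | refl => exact self_mem_chain _
    | tail _ hab ih =>
      obtain ⟨_, ⟨ψ, hψ, O, τ, hO, hOc, hsub, rfl⟩, ⟨⟨o, _⟩, ⟨ho, rfl⟩, rfl⟩,
        ⟨⟨o', _⟩, ⟨ho', rfl⟩, rfl⟩⟩ := hab
      -- A plaque of an arbitrary chart of the maximal atlas agrees locally with lifts over the
      -- chosen boxes; connectedness of `O` links the local pieces.
      refine chain_trans ih (hOc.isPreconnected.induction₂'
        (fun o o' => ψ.symm (o', _) ∈ c.chain (ψ.symm (o, _))) (fun a ha => ?_)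
        (fun _ _ _ _ _ _ h h' => chain_trans h h') ho ho')
      have ht : (a, _) ∈ ψ.target := hsub ⟨ha, rfl⟩
      obtain ⟨N, hN, hNs, hNc⟩ := exists_nhds_card_compat hψ (hchart (c.proj (ψ.symm (a, _))))
        (ψ.map_target ht) (c.mem_box (c.proj (ψ.symm (a, _))))
      have hcont := (ψ.continuousAt_symm ht).comp
        (f := fun b : EuclideanSpace ℝ (Fin n) => (b, _)) (x := a) (by fun_prop)
      filter_upwards [nhdsWithin_le_nhds (hcont hN), self_mem_nhdsWithin] with b hb hbO
      have hbt : (b, _) ∈ ψ.target := hsub ⟨hbO, rfl⟩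
      have h2 := (chart_snd_eq_iff (hNs (mem_of_mem_nhds hN)).2 (hNs hb).2).1
        (hNc _ (mem_of_mem_nhds hN) _ hb (by
          simp only [Function.comp_apply]
          rw [ψ.right_inv ht, ψ.right_inv hbt]))
      exact ⟨mem_chain_of_rel h2, chain_symm (mem_chain_of_rel h2)⟩
  · induction he' with
    | refl => exact self_mem_leaf _
    | @tail a b _ hab ih =>
      obtain ⟨y, hy⟩ := hab
      have hya := c.rel_mem _ _ _ hy
      have hyb := c.rel_mem' hy
      refine leaf_trans ih (Relation.ReflTransGen.single
        ⟨_, ⟨c.chart y, hchart y, (c.box y).base, (c.chart y a).2, (c.box y).base_open,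
          (c.box y).base_connected, ?_, rfl⟩, ?_, ?_⟩)
      · rintro ⟨o, _⟩ ⟨ho, rfl⟩
        refine ⟨ho, ?_⟩
        rw [chart_snd hya]
        exact ⟨_, rfl⟩
      · exact ⟨c.chart y a, ⟨FlowBox.chart_fst_mem hya, rfl⟩, (c.chart y).left_inv hya⟩
      · exact ⟨c.chart y b, ⟨FlowBox.chart_fst_mem hyb, ((chart_snd_eq_iff hya hyb).2 hy).symm⟩,
          (c.chart y).left_inv hyb⟩

theorem isLaminationMap_proj :
    @IsLaminationMap n c.Transversal _ E _ c.chartedSpace n T _ M _ _ c.proj := by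
  let _ := c.chartedSpace
  have := c.isLamination
  refine ⟨continuous_proj, fun e => ⟨c.proj e, ?_⟩, fun e => ?_⟩
  · rw [leaf_eq_chain]
    rintro _ ⟨e', he', rfl⟩
    exact proj_mem_leaf he'
  · let y := c.proj e
    have hy : y ∈ (c.box y).carrier := c.mem_box y
    have ha := center_mem (c := c) y
    refine ⟨(c.chart y).symm '' ({((c.box y).chart y).1} ×ˢ range (Sigma.mk y)),
      (c.box y).chart.symm '' ({((c.box y).chart y).1} ×ˢ (c.box y).trans),
      ⟨c.chart y, StructureGroupoid.subset_maximalAtlas _ ⟨y, rfl⟩, _, _, isOpen_range_sigmaMk,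
        ?_, rfl⟩, ?_,
      ⟨(c.box y).chart, (c.box y).chart_mem, _, _, (c.box y).trans_open, ?_, rfl⟩, ?_, ?_⟩
    · exact prod_mono_left (singleton_subset_iff.2 ha)
    · refine ⟨c.chart y e, ⟨rfl, ?_⟩, (c.chart y).left_inv hy⟩
      rw [chart_snd hy]
      exact ⟨_, rfl⟩
    · exact (prod_mono_left (singleton_subset_iff.2 ha)).trans (c.box y).subset_target
    · exact ⟨(c.box y).chart y, ⟨rfl, FlowBox.chart_snd_mem hy⟩, FlowBox.point_chart hy⟩
    · rintro _ ⟨_, ⟨⟨a, _⟩, ⟨h, ⟨f, rfl⟩⟩, rfl⟩, rfl⟩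
      obtain rfl : a = _ := h
      refine ⟨(_, ((c.box y).chart (c.proj f.1)).2), ⟨rfl, FlowBox.chart_snd_mem f.2.1⟩, ?_⟩
      exact (proj_transport f.2.1 ha).symm

end Consequences

theorem exists_lamination {n : ℕ} {T : Type v} [TopologicalSpace T] {M : Type u}
    [TopologicalSpace M] [ChartedSpace (EuclideanSpace ℝ (Fin n) × T) M] [IsLamination n T M]
    {E : Type w} (c : PlaqueCover n T M E)
    (hM : ∀ y : M, SecondCountableTopology (LeafSpace n T y))
    (hfib : ∀ z, ¬ (c.proj ⁻¹' {z}).Countable) :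
    ∃ (_ : TopologicalSpace E) (T' : Type (max u w)) (_ : TopologicalSpace T')
      (_ : ChartedSpace (EuclideanSpace ℝ (Fin n) × T') E),
      IsLamination n T' E ∧ (∀ e : E, leaf n T' e = c.chain e) ∧
      (∀ e : E, IsNowhereDense (c.chain e)) ∧
      IsLaminationMap n T' n T c.proj ∧ IsOpenMap c.proj := by
  let _ := c.topology
  have : c.HasPlaqueTopology := ⟨rfl⟩
  exact ⟨_, c.Transversal, _, c.chartedSpace, isLamination, leaf_eq_chain,
    isNowhereDense_chain hM hfib, isLaminationMap_proj, isOpenMap_proj hfib⟩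

end PlaqueCover

/-! ### Reduction of statements along leaves to small flow boxes. -/

section LeafInduction

variable {n : ℕ} {T : Type v} [TopologicalSpace T]
  {M : Type u} [TopologicalSpace M] [ChartedSpace (EuclideanSpace ℝ (Fin n) × T) M]
  [IsLamination n T M]

theorem leaf_induction {Q : M → M → Prop} (hrefl : ∀ y, Q y y)
    (htrans : ∀ y y' y'', Q y y' → Q y' y'' → Q y y'')
    (h : ∀ y, ∃ B : FlowBox n T M, y ∈ B.carrier ∧
      ∀ y' ∈ B.carrier, (B.chart y).2 = (B.chart y').2 → Q y y' ∧ Q y' y)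
    {y y' : M} (hy : y' ∈ leaf n T y) : Q y y' := by
  induction hy with
  | refl => exact hrefl _
  | tail _ hab ih =>
    obtain ⟨_, ⟨ψ, hψ, O, τ, hO, hOc, hsub, rfl⟩, ⟨⟨o, _⟩, ⟨ho, rfl⟩, rfl⟩,
      ⟨⟨o', _⟩, ⟨ho', rfl⟩, rfl⟩⟩ := hab
    refine htrans _ _ _ ih (hOc.isPreconnected.induction₂'
      (fun o o' => Q (ψ.symm (o, _)) (ψ.symm (o', _))) (fun a ha => ?_)
      (fun _ _ _ _ _ _ h h' => htrans _ _ _ h h') ho ho')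
    have ht : (a, _) ∈ ψ.target := hsub ⟨ha, rfl⟩
    obtain ⟨B, hB, hQ⟩ := h (ψ.symm (a, _))
    obtain ⟨N, hN, hNs, hNc⟩ := exists_nhds_card_compat hψ B.chart_mem
      (ψ.map_target ht) (FlowBox.mem_carrier_iff.1 hB).1
    have hcont := (ψ.continuousAt_symm ht).comp
      (f := fun b : EuclideanSpace ℝ (Fin n) => (b, _)) (x := a) (by fun_prop)
    filter_upwards [nhdsWithin_le_nhds (hcont (inter_mem hN (FlowBox.carrier_mem_nhds hB))),
      self_mem_nhdsWithin] with b hb hbO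
    have hbt : (b, _) ∈ ψ.target := hsub ⟨hbO, rfl⟩
    refine hQ _ hb.2 (hNc _ (mem_of_mem_nhds hN) _ hb.1 ?_)
    simp only
    rw [ψ.right_inv ht, ψ.right_inv hbt]

end LeafInduction

/-! ### Lifts of plaques to the covering of the dense leaf. -/

section Lifts

variable {n : ℕ} {T : Type v} [TopologicalSpace T]
  {M : Type u} [TopologicalSpace M] [ChartedSpace (EuclideanSpace ℝ (Fin n) × T) M]
  {x₀ : M} {X : Type w} [TopologicalSpace X] {p : X → LeafSpace n T x₀}

/-- Two points of the cover lie in a common lift of a plaque of the flow box. -/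
def LiftRel (p : X → LeafSpace n T x₀) (B : FlowBox n T M) (z z' : X) : Prop :=
  ∃ t ∈ B.trans, JoinedIn {z : X | (p z).incl ∈ B.plaque t} z z'

namespace LiftRel

variable {B : FlowBox n T M} {z z' z'' : X}

theorem refl (h : (p z).incl ∈ B.carrier) : LiftRel p B z z :=
  ⟨(B.chart (p z).incl).2, FlowBox.chart_snd_mem h,
    JoinedIn.refl ((FlowBox.mem_plaque_iff (FlowBox.chart_snd_mem h)).2 ⟨h, rfl⟩)⟩

theorem symm (h : LiftRel p B z z') : LiftRel p B z' z :=
  let ⟨t, ht, hj⟩ := h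
  ⟨t, ht, hj.symm⟩

theorem trans (h : LiftRel p B z z') (h' : LiftRel p B z' z'') : LiftRel p B z z'' := by
  obtain ⟨t, ht, hj⟩ := h
  obtain ⟨t', ht', hj'⟩ := h'
  obtain rfl := B.plaque_inj ht ht' hj.target_mem hj'.source_mem
  exact ⟨t, ht, hj.trans hj'⟩

theorem mem (h : LiftRel p B z z') : (p z).incl ∈ B.carrier :=
  let ⟨_, ht, hj⟩ := h
  FlowBox.plaque_subset_carrier ht hj.source_mem

theorem mem' (h : LiftRel p B z z') : (p z').incl ∈ B.carrier := h.symm.mem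

theorem snd_eq (h : LiftRel p B z z') : (B.chart (p z).incl).2 = (B.chart (p z').incl).2 := by
  obtain ⟨t, ht, hj⟩ := h
  rw [((FlowBox.mem_plaque_iff ht).1 hj.source_mem).2,
    ((FlowBox.mem_plaque_iff ht).1 hj.target_mem).2]

end LiftRel

theorem LeafSpace.incl_injective : Function.Injective (LeafSpace.incl : LeafSpace n T x₀ → M) :=
  Subtype.val_injective

theorem section_chart_fst {B : FlowBox n T M} {σ : C(B.base, X)} {t : T} (ht : t ∈ B.trans)
    (hσ : ∀ a, (p (σ a)).incl = B.point a t) {z : X} (hz : ∃ a, σ a = z)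
    (hzB : (B.chart (p z).incl).1 ∈ B.base) :
    σ ⟨(B.chart (p z).incl).1, hzB⟩ = z := by
  obtain ⟨a, rfl⟩ := hz
  congr 1
  refine Subtype.ext ?_
  change (B.chart (p (σ a)).incl).1 = a
  rw [hσ, FlowBox.chart_point a.2 ht]

variable [IsLamination n T M] {B : FlowBox n T M}

/-- Over a convex flow box, the lift of a plaque through a point of the cover is the image of a
section. -/
theorem exists_section (hp : IsCoveringMap p) (hB : Convex ℝ B.base) {z : X}
    (hz : (p z).incl ∈ B.carrier) :
    ∃ σ : C(B.base, X), (∀ a, (p (σ a)).incl = B.point a (B.chart (p z).incl).2) ∧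
      ∀ z', LiftRel p B z z' ↔ ∃ a : B.base, σ a = z' := by
  have ht := FlowBox.chart_snd_mem hz
  have hza := FlowBox.chart_fst_mem hz
  have : ContractibleSpace B.base := hB.contractibleSpace ⟨_, hza⟩
  have : LocallyPathConnectedSpace B.base := B.base_open.locallyPathConnectedSpace
  have hleaf : ∀ a : B.base, B.point a (B.chart (p z).incl).2 ∈ leaf n T x₀ := fun a =>
    FlowBox.plaque_subset_leaf (p z).2 hz (FlowBox.point_mem_plaque a.2)
  let f : B.base → LeafSpace n T x₀ := fun a => ⟨_, hleaf a⟩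
  have hf : Continuous f := FlowBox.continuousOn_leafSpace ht fun _ => rfl
  obtain ⟨σ, ⟨hσz, hσ⟩, -⟩ := hp.existsUnique_continuousMap_lifts ⟨f, hf⟩ ⟨_, hza⟩ z
    (LeafSpace.incl_injective (FlowBox.point_chart hz).symm)
  have hσ' : ∀ a, (p (σ a)).incl = B.point a (B.chart (p z).incl).2 := fun a =>
    congrArg LeafSpace.incl (congrFun hσ a)
  refine ⟨σ, hσ', fun z' => ⟨?_, ?_⟩⟩
  · rintro ⟨t, htB, γ, hγ⟩
    have hγ' : ∀ r, (p (γ r)).incl ∈ B.carrier ∧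
        (B.chart (p (γ r)).incl).2 = (B.chart (p z).incl).2 := fun r => by
      have h1 := (FlowBox.mem_plaque_iff htB).1 (hγ r)
      have h2 := (FlowBox.mem_plaque_iff htB).1 (hγ 0)
      rw [γ.source] at h2
      exact ⟨h1.1, h1.2.trans h2.2.symm⟩
    -- `γ` and `σ ∘ α` lift the same path and start at `z`, so they coincide, and `γ` ends in the
    -- image of `σ`.
    let α : unitInterval → B.base := fun r => ⟨_, FlowBox.chart_fst_mem (hγ' r).1⟩
    have hα : Continuous α := by
      refine Continuous.subtype_mk (continuous_fst.comp ?_) _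
      exact FlowBox.continuousOn_chart.comp_continuous
        (LeafSpace.continuous_incl.comp (hp.continuous.comp γ.continuous)) fun r => (hγ' r).1
    have heq := hp.eq_of_comp_eq γ.continuous (σ.continuous.comp hα) (funext fun r => by
      refine LeafSpace.incl_injective ?_
      change _ = (p (σ (α r))).incl
      rw [hσ', ← (hγ' r).2]
      exact (FlowBox.point_chart (hγ' r).1).symm) 0 (by
        change γ 0 = σ (α 0)
        have : α 0 = ⟨_, hza⟩ := Subtype.ext (by simp [α])
        rw [this, hσz, γ.source])
    refine ⟨α 1, ?_⟩
    rw [← γ.target]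
    exact (congrFun heq 1).symm
  · rintro ⟨a, rfl⟩
    obtain ⟨γ⟩ := PathConnectedSpace.joined (⟨_, hza⟩ : B.base) a
    refine ⟨_, ht, (γ.map σ.continuous).cast hσz.symm rfl, fun r => ?_⟩
    change (p (σ (γ r))).incl ∈ B.plaque _
    rw [hσ']
    exact FlowBox.point_mem_plaque (γ r).2

theorem LiftRel.ext (hp : IsCoveringMap p) (hB : Convex ℝ B.base) {z z' : X}
    (h : LiftRel p B z z') (hz : (p z).incl = (p z').incl) : z = z' := by
  obtain ⟨σ, hσ, hr⟩ := exists_section hp hB h.mem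
  have ht := FlowBox.chart_snd_mem h.mem
  refine (section_chart_fst ht hσ ((hr z).1 (.refl h.mem))
    (FlowBox.chart_fst_mem h.mem)).symm.trans (Eq.trans ?_
      (section_chart_fst ht hσ ((hr z').1 h) (FlowBox.chart_fst_mem h.mem')))
  congr 2
  rw [hz]

theorem exists_liftRel (hp : IsCoveringMap p) (hB : Convex ℝ B.base) {z : X}
    (hz : (p z).incl ∈ B.carrier) {a : EuclideanSpace ℝ (Fin n)} (ha : a ∈ B.base) :
    ∃ z', LiftRel p B z z' ∧ (p z').incl = B.point a (B.chart (p z).incl).2 := by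
  obtain ⟨σ, hσ, hr⟩ := exists_section hp hB hz
  exact ⟨σ ⟨a, ha⟩, (hr _).2 ⟨_, rfl⟩, hσ ⟨a, ha⟩⟩

/-- Two points in a common lift of a plaque are joined by the lift of a path in the coordinates. -/
theorem LiftRel.exists_path (hp : IsCoveringMap p) (hB : Convex ℝ B.base) {z z' : X}
    (h : LiftRel p B z z') (γ : Path (B.chart (p z).incl).1 (B.chart (p z').incl).1)
    (hγ : ∀ r, γ r ∈ B.base) :
    ∃ η : Path z z', ∀ r, (p (η r)).incl = B.point (γ r) (B.chart (p z).incl).2 := by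
  obtain ⟨σ, hσ, hr⟩ := exists_section hp hB h.mem
  have ht := FlowBox.chart_snd_mem h.mem
  refine ⟨⟨⟨fun r => σ ⟨γ r, hγ r⟩, by fun_prop⟩, ?_, ?_⟩, fun r => hσ ⟨γ r, hγ r⟩⟩
  · have := section_chart_fst ht hσ ((hr z).1 (.refl h.mem)) (FlowBox.chart_fst_mem h.mem)
    simpa using this
  · have := section_chart_fst ht hσ ((hr z').1 h) (FlowBox.chart_fst_mem h.mem')
    simpa using this

/-- The given joining path may wander far. It is replaced by the lift of a path inside a small
convex box with the chart of `B`, on which cards of `B` go into cards of `B'`. -/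
theorem LiftRel.local (hp : IsCoveringMap p) (hB : Convex ℝ B.base) {B' : FlowBox n T M} {y : M}
    (hy : y ∈ B.carrier) (hy' : y ∈ B'.carrier) :
    ∃ V ∈ 𝓝 y, ∀ z z', (p z).incl ∈ V → (p z').incl ∈ V → LiftRel p B z z' →
      LiftRel p B' z z' := by
  obtain ⟨N, hN, -, hNc⟩ := exists_nhds_card_compat B.chart_mem B'.chart_mem
    (FlowBox.mem_carrier_iff.1 hy).1 (FlowBox.mem_carrier_iff.1 hy').1
  obtain ⟨B₃, hch, hB₃, hy₃, hsub⟩ := FlowBox.exists_convex_subset B.chart_mem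
    (FlowBox.mem_carrier_iff.1 hy).1
    (inter_mem hN (inter_mem (FlowBox.carrier_mem_nhds hy) (FlowBox.carrier_mem_nhds hy')))
  refine ⟨_, FlowBox.carrier_mem_nhds hy₃, fun z z' hz hz' h => ?_⟩
  have h3 := FlowBox.chart_fst_mem hz
  have h3' := FlowBox.chart_fst_mem hz'
  have ht := FlowBox.chart_snd_mem hz
  rw [hch] at h3 h3' ht
  obtain ⟨γ, hγ⟩ := (hB₃.isPathConnected ⟨_, h3⟩).joinedIn _ h3 _ h3'
  have hpt : ∀ r, B.point (γ r) (B.chart (p z).incl).2 ∈ B₃.carrier := fun r => by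
    have := FlowBox.point_mem_carrier (B := B₃) (hγ r) ht
    rwa [FlowBox.point, hch] at this
  have hγB : ∀ r, γ r ∈ B.base := fun r => by
    have h1 := FlowBox.chart_fst_mem (hsub (hpt r)).2.1
    have h2 : B.chart (B.point (γ r) (B.chart (p z).incl).2) = (γ r, (B.chart (p z).incl).2) := by
      have htar : B₃.base ×ˢ B₃.trans ⊆ B.chart.target := hch ▸ B₃.subset_target
      exact B.chart.right_inv (htar ⟨hγ r, ht⟩)
    rwa [h2] at h1
  obtain ⟨η, hη⟩ := h.exists_path hp hB γ hγB
  refine ⟨(B'.chart (p z).incl).2, FlowBox.chart_snd_mem (hsub hz).2.2, η, fun r => ?_⟩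
  change (p (η r)).incl ∈ B'.plaque _
  rw [hη]
  refine (FlowBox.mem_plaque_iff (FlowBox.chart_snd_mem (hsub hz).2.2)).2
    ⟨(hsub (hpt r)).2.2, hNc _ (hsub (hpt r)).1 _ (hsub hz).1 ?_⟩
  rw [FlowBox.chart_point (hγB r) (FlowBox.chart_snd_mem (hsub hz).2.1)]

/-- Sliding along lifts injects one fibre into another. This gives both surjectivity onto the leaf
and the passage of infinite fibres from `x₀` to other points. -/
theorem mk_fiber_le (hp : IsCoveringMap p) {y y' : M} (h : y' ∈ leaf n T y) :
    Cardinal.mk {z | (p z).incl = y} ≤ Cardinal.mk {z | (p z).incl = y'} := by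
  refine leaf_induction
    (Q := fun y y' => Cardinal.mk {z | (p z).incl = y} ≤ Cardinal.mk {z | (p z).incl = y'})
    (fun _ => le_rfl) (fun _ _ _ => le_trans) (fun y => ?_) h
  obtain ⟨B, hB, hyB, -⟩ := FlowBox.exists_convex_mem_nhds (n := n) (T := T) (univ_mem' fun _ => trivial : univ ∈ 𝓝 y)
  have key : ∀ a ∈ B.carrier, ∀ b ∈ B.carrier, (B.chart a).2 = (B.chart b).2 →
      Cardinal.mk {z | (p z).incl = a} ≤ Cardinal.mk {z | (p z).incl = b} := by
    intro a ha b hb hab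
    have hl : ∀ z : {z | (p z).incl = a}, ∃ z' : {z | (p z).incl = b}, LiftRel p B z.1 z'.1 := by
      rintro ⟨z, rfl⟩
      obtain ⟨z', hz', hz'b⟩ := exists_liftRel hp hB ha (FlowBox.chart_fst_mem hb)
      refine ⟨⟨z', ?_⟩, hz'⟩
      change _ = b
      rw [hz'b, hab, FlowBox.point_chart hb]
    choose k hk using hl
    refine Cardinal.mk_le_of_injective (f := k) fun z z' hzz => Subtype.ext ?_
    refine LiftRel.ext hp hB ((hk z).trans ?_) (z.2.trans z'.2.symm)
    rw [hzz]
    exact (hk z').symm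
  exact ⟨B, hyB, fun y' hy' h => ⟨key _ hyB _ hy' h, key _ hy' _ hyB h.symm⟩⟩

theorem exists_incl_eq [Nonempty X] (hp : IsCoveringMap p) {y : M} (hy : y ∈ leaf n T x₀) :
    ∃ z, (p z).incl = y := by
  let z : X := Classical.arbitrary X
  have h := mk_fiber_le (p := p) hp (leaf_trans (leaf_symm (p z).2) hy)
  have : Nonempty {z' | (p z').incl = (p z).incl} := ⟨z, rfl⟩
  have h2 := (Cardinal.mk_ne_zero_iff.2 this).bot_lt.trans_le h
  obtain ⟨z', hz'⟩ := Cardinal.mk_ne_zero_iff.1 h2.ne'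
  exact ⟨z', hz'⟩

theorem exists_not_liftRel [T2Space M] [Nonempty X] (hp : IsCoveringMap p)
    (hdense : Dense (leaf n T x₀))
    (haccum : (∀ P : Set M, IsPlaque n T P → P ⊆ leaf n T x₀ → ¬ IsOpen P) ∨
      {z : X | (p z).incl = x₀}.Infinite) (hB : Convex ℝ B.base) {y : M} (hy : y ∈ B.carrier)
    {V : Set M} (hV : V ∈ 𝓝 y) {F : Set X} (hF : F.Finite) :
    ∃ z, (p z).incl ∈ V ∧ ∀ x ∈ F, ¬ LiftRel p B z x := by
  obtain ⟨B₃, hch, hB₃, hy₃, hsub⟩ := FlowBox.exists_convex_subset B.chart_mem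
    (FlowBox.mem_carrier_iff.1 hy).1 (inter_mem hV (FlowBox.carrier_mem_nhds hy))
  obtain ⟨q, hq, hqL⟩ := hdense.inter_open_nonempty _ B₃.isOpen_carrier ⟨y, hy₃⟩
  rcases haccum with h | h
  · have hK := hF.image fun x => (B.chart (p x).incl).2
    suffices ∃ q' ∈ B₃.carrier, q' ∈ leaf n T x₀ ∧
        (B.chart q').2 ∉ (fun x => (B.chart (p x).incl).2) '' F by
      obtain ⟨q', hq', hq'L, hq'K⟩ := this
      obtain ⟨z, rfl⟩ := exists_incl_eq hp hq'L
      exact ⟨z, (hsub hq').1, fun x hx hr => hq'K ⟨x, hx, hr.snd_eq.symm⟩⟩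
    by_contra! hall
    -- Otherwise the dense leaf meets the open box left after deleting these finitely many
    -- coordinates.
    have hS : B₃.trans ⊆ (fun x => (B.chart (p x).incl).2) '' F := by
      intro t ht
      by_contra htK
      have ho := B₃.chart.isOpen_image_symm_of_subset_target
        (B₃.base_open.prod (FlowBox.finite_diff_open (B := B₃) hK))
        ((prod_mono_right sdiff_subset).trans B₃.subset_target)
      obtain ⟨a, ha⟩ := B₃.base_connected.nonempty
      obtain ⟨q', ⟨⟨b, s⟩, ⟨hb, hs⟩, rfl⟩, hq'L⟩ :=
        hdense.inter_open_nonempty _ ho ⟨_, ⟨(a, t), ⟨ha, ht, htK⟩, rfl⟩⟩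
      have := hall _ (FlowBox.point_mem_carrier hb hs.1) hq'L
      have hbs : B.chart (B₃.chart.symm (b, s)) = (b, s) := by
        rw [← hch]
        exact FlowBox.chart_point hb hs.1
      rw [FlowBox.point, hbs] at this
      exact hs.2 this
    -- Now `B₃.trans` is finite and the coordinate of `q` is isolated in it, so the plaque through
    -- `q` is open in `M`.
    have hqt := FlowBox.chart_snd_mem hq
    have ho := FlowBox.finite_diff_open (B := B₃)
      (hK.subset (sdiff_subset (t := {(B₃.chart q).2})))
    have hsing : B₃.trans \ ((fun x => (B.chart (p x).incl).2) '' F \ {(B₃.chart q).2}) =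
        {(B₃.chart q).2} := by
      ext t
      constructor
      · rintro ⟨ht, ht'⟩
        by_contra hne
        exact ht' ⟨hS ht, hne⟩
      · rintro rfl
        exact ⟨hqt, fun h' => h'.2 rfl⟩
    rw [hsing] at ho
    refine h _ (FlowBox.isPlaque_plaque hqt) (FlowBox.plaque_subset_leaf hqL hq) ?_
    exact B₃.chart.isOpen_image_symm_of_subset_target (B₃.base_open.prod ho)
      ((prod_mono_right (singleton_subset_iff.2 hqt)).trans B₃.subset_target)
  -- Each of the finitely many lifts contains at most one point of the infinite fibre over `q`.
  · have hinf : {z : X | (p z).incl = q}.Infinite := by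
      rw [← Set.infinite_coe_iff, Cardinal.infinite_iff] at h ⊢
      exact h.trans (mk_fiber_le hp hqL)
    by_contra! hall
    refine hinf ((hF.biUnion (t := fun x => {z | (p z).incl = q ∧ LiftRel p B z x})
      fun x _ => Set.Subsingleton.finite ?_).subset ?_)
    · rintro z ⟨hz, hzx⟩ z' ⟨hz', hzx'⟩
      exact LiftRel.ext hp hB (hzx.trans hzx'.symm) (hz.trans hz'.symm)
    · rintro z rfl
      obtain ⟨x, hx, hr⟩ := hall z (hsub hq).1
      exact mem_biUnion hx ⟨rfl, hr⟩

end Lifts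

/-! ### Reindexing sequences and concatenating convergent paths. -/

theorem Ultrafilter.le_atTop_of_infinite {U : Ultrafilter ℕ} (hU : ∀ s ∈ U, s.Infinite) :
    (U : Filter ℕ) ≤ atTop := by
  rw [← Nat.cofinite_eq_atTop]
  intro A hA
  by_contra hn
  exact hU _ (Ultrafilter.compl_mem_iff_notMem.2 hn) hA

/-- An asymptotic class only sees indices in a set of `U`, but the definition of leaves wants a path
for every index. Reindexing by `ρ` repeats good indices in place of the others. -/
theorem exists_tendsto_retract {A : Set ℕ} (hA : A.Infinite) :
    ∃ ρ : ℕ → ℕ, (∀ k, ρ k ∈ A) ∧ (∀ k ∈ A, ρ k = k) ∧ Tendsto ρ atTop atTop := by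
  have h : ∀ k, ∃ l ∈ A, k ≤ l ∧ (k ∈ A → l = k) := fun k => by
    by_cases hk : k ∈ A
    · exact ⟨k, hk, le_rfl, fun _ => rfl⟩
    · obtain ⟨l, hl, hkl⟩ := hA.exists_gt k
      exact ⟨l, hl, hkl.le, fun h => absurd h hk⟩
  choose ρ h1 h2 h3 using h
  exact ⟨ρ, h1, fun k hk => h3 k hk, tendsto_atTop_mono h2 tendsto_id⟩

/-- Endpoints vary with the index, so convergence is tested on compact sets: each one splits into
its two rescaled halves. -/
theorem Path.tendsto_trans {Y ι : Type*} [TopologicalSpace Y] {l : Filter ι} {a b c : ι → Y}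
    {a' b' c' : Y} {f : ∀ k, Path (a k) (b k)} {h : ∀ k, Path (b k) (c k)} {f' : Path a' b'}
    {h' : Path b' c'} (hf : Tendsto (fun k => (f k).toContinuousMap) l (𝓝 f'.toContinuousMap))
    (hh : Tendsto (fun k => (h k).toContinuousMap) l (𝓝 h'.toContinuousMap)) :
    Tendsto (fun k => ((f k).trans (h k)).toContinuousMap) l (𝓝 (f'.trans h').toContinuousMap) := by
  rw [ContinuousMap.tendsto_nhds_compactOpen] at hf hh ⊢
  intro K hK U hU hKU
  have hK₁ : IsCompact {r : unitInterval | (r : ℝ) / 2 ∈ Subtype.val '' K} := by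
    refine IsClosed.isCompact ?_
    exact (hK.image continuous_subtype_val).isClosed.preimage (by fun_prop)
  have hK₂ : IsCompact {r : unitInterval | ((r : ℝ) + 1) / 2 ∈ Subtype.val '' K} := by
    refine IsClosed.isCompact ?_
    exact (hK.image continuous_subtype_val).isClosed.preimage (by fun_prop)
  have hm₁ : MapsTo f'.toContinuousMap {r | (r : ℝ) / 2 ∈ Subtype.val '' K} U := by
    rintro r ⟨q, hq, hqr⟩
    have := hKU hq
    change (f'.trans h') q ∈ U at this
    rw [Path.trans_apply, dif_pos (by rw [hqr]; linarith [r.2.2])] at this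
    convert this
    refine congrArg f' (Subtype.ext ?_)
    change (r : ℝ) = 2 * (q : ℝ)
    linarith
  have hm₂ : MapsTo h'.toContinuousMap {r | ((r : ℝ) + 1) / 2 ∈ Subtype.val '' K} U := by
    rintro r ⟨q, hq, hqr⟩
    have := hKU hq
    change (f'.trans h') q ∈ U at this
    rw [Path.trans_apply] at this
    split_ifs at this with hq2
    -- At the midpoint concatenation uses the first path, whose end is the start of the second.
    · have hr : r = 0 := Subtype.ext (le_antisymm (by rw [hqr] at hq2; simp; linarith) r.2.1)
      subst hr
      change h' 0 ∈ U
      rw [h'.source, ← f'.target]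
      convert this
      rw [hqr]; simp
    · convert this
      refine congrArg h' (Subtype.ext ?_)
      change (r : ℝ) = 2 * (q : ℝ) - 1
      linarith
  filter_upwards [hf _ hK₁ U hU hm₁, hh _ hK₂ U hU hm₂] with k h1 h2 q hq
  change ((f k).trans (h k)) q ∈ U
  rw [Path.trans_apply]
  split_ifs with hq2
  · exact h1 (x := ⟨2 * q, _⟩) ⟨q, hq, by simp⟩
  · exact h2 (x := ⟨2 * q - 1, _⟩) ⟨q, hq, by simp⟩

/-! ### The germ universal cover as a plaque cover with uncountable fibres. -/

section Germ

variable {n : ℕ} {T : Type v} [TopologicalSpace T]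
  {M : Type u} [TopologicalSpace M] [ChartedSpace (EuclideanSpace ℝ (Fin n) × T) M]
  {x₀ : M} {X : Type w} [TopologicalSpace X] {p : X → LeafSpace n T x₀}
  {U : Ultrafilter ℕ} {hU : ∀ s ∈ U, s.Infinite}

/-- The limits of two sequences lie in the flow box, and almost all of their terms lie in a common
lift of a plaque. -/
def SeqRel (U : Ultrafilter ℕ) (B : FlowBox n T M) (s s' : LConvergentSeq p) : Prop :=
  s.lim ∈ B.carrier ∧ s'.lim ∈ B.carrier ∧
    ∀ᶠ k in (U : Filter ℕ), LiftRel p B (s.seq k) (s'.seq k)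

namespace SeqRel

variable {B : FlowBox n T M} {s s' s'' : LConvergentSeq p}

theorem symm (h : SeqRel U B s s') : SeqRel U B s' s :=
  ⟨h.2.1, h.1, h.2.2.mono fun _ h => h.symm⟩

theorem trans (h : SeqRel U B s s') (h' : SeqRel U B s' s'') : SeqRel U B s s'' :=
  ⟨h.1, h'.2.1, h.2.2.mp (h'.2.2.mono fun _ h h' => h'.trans h)⟩

theorem of_isAsymptotic (h : IsAsymptotic U s s') (hs : s.lim ∈ B.carrier) : SeqRel U B s s' :=
  ⟨hs, h.1 ▸ hs, h.2 B hs⟩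

/-- Limits need not be unique in `T`, so the coordinates are moved onto one transversal of the
Hausdorff space `M`. -/
theorem snd_eq [T2Space M] (hU : ∀ s ∈ U, s.Infinite) (h : SeqRel U B s s') : (B.chart s.lim).2 = (B.chart s'.lim).2 := by
  obtain ⟨a, ha⟩ := B.base_connected.nonempty
  have key : ∀ s : LConvergentSeq p, s.lim ∈ B.carrier →
      Tendsto (fun k => B.point a (B.chart (p (s.seq k)).incl).2) U
        (𝓝 (B.point a (B.chart s.lim).2)) := by
    intro s hs
    have h1 : Tendsto (fun k => (a, (B.chart (p (s.seq k)).incl).2)) U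
        (𝓝 (a, (B.chart s.lim).2)) :=
      tendsto_const_nhds.prodMk_nhds ((continuous_snd.tendsto _).comp
        (((FlowBox.continuousOn_chart.continuousAt (FlowBox.carrier_mem_nhds hs)).tendsto.comp
          s.tendsto).mono_left (Ultrafilter.le_atTop_of_infinite hU)))
    exact (FlowBox.continuousOn_point.continuousAt (x := (a, (B.chart s.lim).2)) ((B.base_open.prod B.trans_open).mem_nhds
      ⟨ha, FlowBox.chart_snd_mem hs⟩)).tendsto.comp h1
  have h2 := tendsto_nhds_unique_of_eventuallyEq (key s h.1) (key s' h.2.1)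
    (h.2.2.mono fun k hk => by
      simp only [hk.snd_eq])
  have h3 := congrArg (fun y => (B.chart y).2) h2
  simpa only [FlowBox.chart_point ha (FlowBox.chart_snd_mem h.1),
    FlowBox.chart_point ha (FlowBox.chart_snd_mem h.2.1)] using h3

/-- By `LiftRel.local`, a single convex box about the limit decides the condition for all boxes. -/
theorem isAsymptotic [IsLamination n T M] (hU : ∀ s ∈ U, s.Infinite) (hp : IsCoveringMap p) (hB : Convex ℝ B.base)
    (h : SeqRel U B s s') (hl : s.lim = s'.lim) : IsAsymptotic U s s' := by
  refine ⟨hl, fun B' hB' => ?_⟩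
  obtain ⟨V, hV, hloc⟩ := LiftRel.local hp hB h.1 hB'
  have hle := Ultrafilter.le_atTop_of_infinite hU
  filter_upwards [h.2.2, hle (s.tendsto hV), hle (s'.tendsto (hl ▸ hV))] with k h1 h2 h3
  exact hloc _ _ h2 h3 h1

end SeqRel

namespace GermUniversalCover

theorem mk_eq_iff {s s' : LConvergentSeq p} :
    (mk s : GermUniversalCover p U hU) = mk s' ↔ IsAsymptotic U s s' :=
  Quotient.eq (r := asymptoticSetoid p U hU)

theorem exists_mk (e : GermUniversalCover p U hU) : ∃ s, mk s = e :=
  Quotient.exists_rep (s := asymptoticSetoid p U hU) e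

theorem mk_eq_of_eventuallyEq {s s' : LConvergentSeq p} (hl : s.lim = s'.lim)
    (h : ∀ᶠ k in (U : Filter ℕ), s.seq k = s'.seq k) :
    (mk s : GermUniversalCover p U hU) = mk s' := by
  refine mk_eq_iff.2 ⟨hl, fun B hB => ?_⟩
  filter_upwards [h, ((isAsymptotic_equivalence U hU).refl s).2 B hB] with k hk hr
  rw [← hk]
  exact hr

/-- Almost all terms of the two sequences lie in a common lift of a plaque of the flow box. -/
def Rel (B : FlowBox n T M) (e e' : GermUniversalCover p U hU) : Prop :=
  ∃ s s', mk s = e ∧ mk s' = e' ∧ SeqRel U B s s'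

theorem rel_mk_iff {B : FlowBox n T M} {s s' : LConvergentSeq p} :
    Rel B (mk s : GermUniversalCover p U hU) (mk s') ↔ SeqRel U B s s' := by
  refine ⟨?_, fun h => ⟨s, s', rfl, rfl, h⟩⟩
  rintro ⟨r, r', h, h', hr⟩
  exact ((SeqRel.of_isAsymptotic (mk_eq_iff.1 h) hr.1).symm.trans hr).trans
    (SeqRel.of_isAsymptotic (mk_eq_iff.1 h') hr.2.1)

variable [IsLamination n T M]

/-- A chosen convex flow box about a point. -/
noncomputable def convexBox (y : M) : FlowBox n T M :=
  (FlowBox.exists_convex_mem_nhds (n := n) (T := T) (univ_mem : univ ∈ 𝓝 y)).choose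

theorem convex_convexBox (y : M) : Convex ℝ (convexBox (n := n) (T := T) y).base :=
  (FlowBox.exists_convex_mem_nhds (n := n) (T := T) (univ_mem : univ ∈ 𝓝 y)).choose_spec.1

theorem mem_convexBox (y : M) : y ∈ (convexBox (n := n) (T := T) y).carrier :=
  (FlowBox.exists_convex_mem_nhds (n := n) (T := T) (univ_mem : univ ∈ 𝓝 y)).choose_spec.2.1

theorem exists_rel_point (hp : IsCoveringMap p) {B : FlowBox n T M} (hB : Convex ℝ B.base)
    (s : LConvergentSeq p) (hs : s.lim ∈ B.carrier) {a : EuclideanSpace ℝ (Fin n)}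
    (ha : a ∈ B.base) :
    ∃ s' : LConvergentSeq p, (U : Filter ℕ) ≤ atTop → SeqRel U B s s' ∧
      s'.lim = B.point a (B.chart s.lim).2 := by
  have h : ∀ k, ∃ z, (p (s.seq k)).incl ∈ B.carrier → LiftRel p B (s.seq k) z ∧
      (p z).incl = B.point a (B.chart (p (s.seq k)).incl).2 := fun k => by
    by_cases hk : (p (s.seq k)).incl ∈ B.carrier
    · obtain ⟨z, hz⟩ := exists_liftRel hp hB hk ha
      exact ⟨z, fun _ => hz⟩
    · exact ⟨s.seq k, fun h => absurd h hk⟩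
  choose z hz using h
  have hev := s.tendsto (FlowBox.carrier_mem_nhds hs)
  have h1 : Tendsto (fun k => (a, (B.chart (p (s.seq k)).incl).2)) atTop
      (𝓝 (a, (B.chart s.lim).2)) :=
    tendsto_const_nhds.prodMk_nhds ((continuous_snd.tendsto _).comp
      ((FlowBox.continuousOn_chart.continuousAt (FlowBox.carrier_mem_nhds hs)).tendsto.comp
        s.tendsto))
  have h2 := (FlowBox.continuousOn_point.continuousAt (x := (a, (B.chart s.lim).2)) ((B.base_open.prod B.trans_open).mem_nhds
      ⟨ha, FlowBox.chart_snd_mem hs⟩)).tendsto.comp h1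
  refine ⟨⟨z, _, h2.congr' ?_⟩, fun hle => ⟨⟨hs, ?_, hle ?_⟩, rfl⟩⟩
  · filter_upwards [hev] with k hk
    exact (hz k hk).2.symm
  · exact FlowBox.point_mem_carrier ha (FlowBox.chart_snd_mem hs)
  · filter_upwards [hev] with k hk
    exact (hz k hk).1

variable (p U hU) in
/-- The germ universal cover as a set with lifts of plaques. -/
noncomputable def plaqueCover [T2Space M] (hp : IsCoveringMap p) :
    PlaqueCover n T M (GermUniversalCover p U hU) where
  box := convexBox
  mem_box := mem_convexBox
  proj := limProj
  rel y := Rel (convexBox y)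
  rel_refl y e he := by
    obtain ⟨s, rfl⟩ := exists_mk e
    exact rel_mk_iff.2 (SeqRel.of_isAsymptotic ((isAsymptotic_equivalence U hU).refl s) he)
  rel_symm y e e' := fun ⟨s, s', h, h', hr⟩ => ⟨s', s, h', h, hr.symm⟩
  rel_trans y e e' e'' h h' := by
    obtain ⟨s, rfl⟩ := exists_mk e
    obtain ⟨s', rfl⟩ := exists_mk e'
    obtain ⟨s'', rfl⟩ := exists_mk e''
    exact rel_mk_iff.2 ((rel_mk_iff.1 h).trans (rel_mk_iff.1 h'))
  rel_mem y e e' h := by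
    obtain ⟨s, s', rfl, rfl, hr⟩ := h
    exact hr.1
  rel_plaque y e e' h := by
    obtain ⟨s, s', rfl, rfl, hr⟩ := h
    exact hr.snd_eq (hU := hU)
  rel_ext y e e' h hl := by
    obtain ⟨s, s', rfl, rfl, hr⟩ := h
    exact mk_eq_iff.2 (hr.isAsymptotic (hU := hU) hp (convex_convexBox y) hl)
  rel_lift y e he a ha := by
    obtain ⟨s, rfl⟩ := exists_mk e
    obtain ⟨s', hs'⟩ := exists_rel_point (U := U) hp (convex_convexBox y) s he ha
    obtain ⟨h1, h2⟩ := hs' (Ultrafilter.le_atTop_of_infinite hU)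
    exact ⟨mk s', rel_mk_iff.2 h1, h2⟩
  rel_local y y' z hz hz' := by
    obtain ⟨V, hV, hloc⟩ := LiftRel.local hp (convex_convexBox y) hz hz'
    -- The interior makes `V` a neighbourhood of each limit, so the sequences eventually enter it.
    refine ⟨interior V ∩ (convexBox y').carrier,
      inter_mem (interior_mem_nhds.2 hV) (FlowBox.carrier_mem_nhds hz'), fun e e' he he' h => ?_⟩
    obtain ⟨s, s', rfl, rfl, hr⟩ := h
    have hle := Ultrafilter.le_atTop_of_infinite hU
    refine rel_mk_iff.2 ⟨he.2, he'.2, ?_⟩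
    filter_upwards [hr.2.2, hle (s.tendsto (mem_interior_iff_mem_nhds.1 he.1)),
      hle (s'.tendsto (mem_interior_iff_mem_nhds.1 he'.1))] with k h1 h2 h3
    exact hloc _ _ h2 h3 h1

/-- Diagonal argument: for a fibre numbered by `f`, choose the `k`-th term in the `k`-th
neighbourhood of `y`, off the lifts through the `k`-th terms of all representatives numbered at most
`k`. -/
theorem not_countable_fiber [T2Space M] [FirstCountableTopology M] [Nonempty X]
    (hp : IsCoveringMap p) (hdense : Dense (_root_.leaf n T x₀))
    (haccum : (∀ P : Set M, IsPlaque n T P → P ⊆ _root_.leaf n T x₀ → ¬ IsOpen P) ∨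
      {z : X | (p z).incl = x₀}.Infinite) (y : M) :
    ¬ ((limProj : GermUniversalCover p U hU → M) ⁻¹' {y}).Countable := by
  intro hc
  obtain ⟨f, hf⟩ := Set.countable_iff_exists_injOn.1 hc
  obtain ⟨V, hV⟩ := (𝓝 y).exists_antitone_basis
  choose rep hrep using exists_mk (p := p) (U := U) (hU := hU)
  have hfin : ∀ k, ((fun e => (rep e).seq k) '' {e | limProj e = y ∧ f e ≤ k}).Finite := fun k => by
    refine Set.Finite.image _ (Set.Finite.of_finite_image ((finite_Iic k).subset ?_)
      (hf.mono fun e he => he.1))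
    rintro _ ⟨e, he, rfl⟩
    exact he.2
  have h : ∀ k, ∃ z, (p z).incl ∈ V k ∧
      ∀ x ∈ (fun e => (rep e).seq k) '' {e | limProj e = y ∧ f e ≤ k},
        ¬ LiftRel p (convexBox y) z x := fun k =>
    exists_not_liftRel hp hdense haccum (convex_convexBox y) (mem_convexBox y)
      (hV.1.mem_of_mem trivial) (hfin k)
  choose z hzV hz using h
  let s : LConvergentSeq p := ⟨z, y, hV.tendsto hzV⟩
  let e : GermUniversalCover p U hU := mk s
  have has := (mk_eq_iff.1 (hrep e).symm).2 (convexBox y) (mem_convexBox y)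
  -- The new class has its own number `f e`; at a large index the new sequence should both share and
  -- avoid the lift of its chosen representative.
  obtain ⟨k, hk, hk'⟩ := (has.and
    (Ultrafilter.le_atTop_of_infinite hU (eventually_ge_atTop (f e)))).exists
  exact hz k _ ⟨e, ⟨rfl, hk'⟩, rfl⟩ hk

end GermUniversalCover

end Germ

/-! ### Leaves of the germ universal cover as chains of lifts. -/

section GermLeaves

variable {n : ℕ} {T : Type v} [TopologicalSpace T]
  {M : Type u} [TopologicalSpace M] [ChartedSpace (EuclideanSpace ℝ (Fin n) × T) M]
  {x₀ : M} {X : Type w} [TopologicalSpace X] {p : X → LeafSpace n T x₀}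
  {U : Ultrafilter ℕ} {hU : ∀ s ∈ U, s.Infinite}

/-- The path between two points of a plaque of a convex flow box that is straight in the
coordinates. -/
noncomputable def FlowBox.linePath (B : FlowBox n T M) (hB : Convex ℝ B.base)
    {a b : EuclideanSpace ℝ (Fin n)} {t : T} (ha : a ∈ B.base) (hb : b ∈ B.base)
    (ht : t ∈ B.trans) : Path (B.point a t) (B.point b t) where
  toFun r := B.point (AffineMap.lineMap a b (r : ℝ)) t
  continuous_toFun := FlowBox.continuousOn_point.comp_continuous
    (f := fun r : unitInterval => (AffineMap.lineMap a b (r : ℝ), t))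
    ((AffineMap.lineMap_continuous.comp continuous_subtype_val).prodMk continuous_const)
    fun r => ⟨hB.lineMap_mem ha hb r.2, ht⟩
  source' := by simp
  target' := by simp

/-- The pairs of points in a common plaque of a flow box, in coordinates. -/
def FlowBox.lineParams (B : FlowBox n T M) :
    Set (EuclideanSpace ℝ (Fin n) × EuclideanSpace ℝ (Fin n) × T) :=
  {q | q.1 ∈ B.base ∧ q.2.1 ∈ B.base ∧ q.2.2 ∈ B.trans}

theorem FlowBox.continuous_linePath (B : FlowBox n T M) (hB : Convex ℝ B.base) :
    Continuous fun q : B.lineParams =>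
      (B.linePath hB q.2.1 q.2.2.1 q.2.2.2).toContinuousMap := by
  refine ContinuousMap.continuous_of_continuous_uncurry _ ?_
  have hc : Continuous fun q : B.lineParams × unitInterval =>
      (AffineMap.lineMap q.1.1.1 q.1.1.2.1 (q.2 : ℝ), q.1.1.2.2) := by
    simp only [AffineMap.lineMap_apply_module]
    fun_prop
  exact FlowBox.continuousOn_point.comp_continuous hc
    fun q => ⟨hB.lineMap_mem q.1.2.1 q.1.2.2.1 q.2.2, q.1.2.2.2⟩

/-- A subsequence of a convergent sequence. -/
def LConvergentSeq.comp (s : LConvergentSeq p) (ρ : ℕ → ℕ) (hρ : Tendsto ρ atTop atTop) :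
    LConvergentSeq p :=
  ⟨s.seq ∘ ρ, s.lim, s.tendsto.comp hρ⟩

namespace GermUniversalCover

theorem self_mem_leaf (e : GermUniversalCover p U hU) : e ∈ e.leaf := by
  obtain ⟨s, rfl⟩ := exists_mk e
  refine ⟨rfl, s, s, rfl, rfl, fun k => Path.refl _,
    fun k => ContinuousMap.const _ (p (s.seq k)).incl, Path.refl _, fun _ _ => rfl, ?_⟩
  exact (ContinuousMap.continuous_const'.tendsto s.lim).comp s.tendsto

/-- Plaques are open in the leaf topology, so a path in the cover cannot change plaque while it
stays over the box. -/
theorem liftRel_of_isPreconnected (hp : IsCoveringMap p) {B : FlowBox n T M}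
    {z z' : X} (η : Path z z') {N : Set unitInterval} (hN : IsPreconnected N)
    (hη : ∀ r ∈ N, (p (η r)).incl ∈ B.carrier) {r r' : unitInterval} (hr : r ∈ N) (hr' : r' ∈ N) :
    LiftRel p B (η r) (η r') := by
  refine hN.induction₂' (fun r r' => LiftRel p B (η r) (η r')) (fun q hq => ?_)
    (fun _ _ _ _ _ _ h h' => h.trans h') hr hr'
  have ht := FlowBox.chart_snd_mem (hη q hq)
  have ho := (LeafSpace.isOpen_plaque (x := x₀) (FlowBox.isPlaque_plaque ht)).preimage
    (hp.continuous.comp η.continuous)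
  have hqo : q ∈ (p ∘ η) ⁻¹' (LeafSpace.incl ⁻¹' B.plaque (B.chart (p (η q)).incl).2) :=
    (FlowBox.mem_plaque_iff ht).2 ⟨hη q hq, rfl⟩
  have : LocallyPathConnectedSpace unitInterval := (convex_Icc 0 1).locallyPathConnectedSpace
  obtain ⟨W, ⟨hW, hWc⟩, hWsub⟩ := (path_connected_basis q).mem_iff.1 (ho.mem_nhds hqo)
  filter_upwards [nhdsWithin_le_nhds hW] with q' hq'
  obtain ⟨δ, hδ⟩ := hWc.joinedIn q (mem_of_mem_nhds hW) q' hq'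
  have hrel : LiftRel p B (η q) (η q') :=
    ⟨_, ht, δ.map η.continuous, fun r => hWsub (hδ r)⟩
  exact ⟨hrel, hrel.symm⟩

variable [IsLamination n T M]

theorem mem_leaf_of_rel [T2Space M] (hp : IsCoveringMap p) {B : FlowBox n T M}
    (hB : Convex ℝ B.base) {e e' e'' : GermUniversalCover p U hU} (he : e' ∈ e.leaf)
    (h : Rel B e' e'') : e'' ∈ e.leaf := by
  obtain ⟨hleaf, s, s', rfl, rfl, η, g, γ, hg, hγ⟩ := he
  obtain ⟨s'', rfl⟩ := exists_mk e''
  have hr := rel_mk_iff.1 h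
  have hsnd := hr.snd_eq hU
  refine ⟨hleaf.trans (leaf_eq_of_mem (FlowBox.mem_leaf_of_snd_eq hr.1 hr.2.1 hsnd)), ?_⟩
  -- After reindexing, the terms are related at every index and the classes are unchanged.
  obtain ⟨ρ, hρA, hρ, hρt⟩ := exists_tendsto_retract (hU _ hr.2.2)
  have hcomp : ∀ s : LConvergentSeq p,
      (mk (s.comp ρ hρt) : GermUniversalCover p U hU) = mk s := fun s =>
    mk_eq_of_eventuallyEq rfl (by
      filter_upwards [hr.2.2] with k hk
      exact congrArg s.seq (hρ k hk))
  have hrel : ∀ k, LiftRel p B (s'.seq (ρ k)) (s''.seq (ρ k)) := hρA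
  have ha := fun k => FlowBox.chart_fst_mem (hrel k).mem
  have hb := fun k => FlowBox.chart_fst_mem (hrel k).mem'
  have ht := fun k => FlowBox.chart_snd_mem (hrel k).mem
  have hη : ∀ k, ∃ ζ : Path (s'.seq (ρ k)) (s''.seq (ρ k)),
      ∀ r, (p (ζ r)).incl = B.linePath hB (ha k) (hb k) (ht k) r := fun k =>
    (hrel k).exists_path hp hB
      ⟨⟨fun r => AffineMap.lineMap _ _ (r : ℝ),
        AffineMap.lineMap_continuous.comp continuous_subtype_val⟩, by simp, by simp⟩
      fun r => hB.lineMap_mem (ha k) (hb k) r.2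
  choose ζ hζ using hη
  have hchart : ∀ s : LConvergentSeq p, s.lim ∈ B.carrier →
      Tendsto (fun k => B.chart (p (s.seq (ρ k))).incl) atTop (𝓝 (B.chart s.lim)) := fun s hs =>
    (FlowBox.continuousOn_chart.continuousAt (FlowBox.carrier_mem_nhds hs)).tendsto.comp
      (s.tendsto.comp hρt)
  have hc : Continuous fun z => (p z).incl := LeafSpace.continuous_incl.comp hp.continuous
  have hq : Tendsto (fun k => (⟨((B.chart (p (s'.seq (ρ k))).incl).1,
      (B.chart (p (s''.seq (ρ k))).incl).1, (B.chart (p (s'.seq (ρ k))).incl).2),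
      ha k, hb k, ht k⟩ : B.lineParams)) atTop
      (𝓝 ⟨((B.chart s'.lim).1, (B.chart s''.lim).1, (B.chart s'.lim).2),
        FlowBox.chart_fst_mem hr.1, FlowBox.chart_fst_mem hr.2.1, FlowBox.chart_snd_mem hr.1⟩) :=
    tendsto_subtype_rng.2 (((continuous_fst.tendsto _).comp (hchart s' hr.1)).prodMk_nhds
      (((continuous_fst.tendsto _).comp (hchart s'' hr.2.1)).prodMk_nhds
        ((continuous_snd.tendsto _).comp (hchart s' hr.1))))
  have hline := ((B.continuous_linePath hB).tendsto _).comp hq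
  let δ : Path s'.lim s''.lim := (B.linePath hB (FlowBox.chart_fst_mem hr.1)
    (FlowBox.chart_fst_mem hr.2.1) (FlowBox.chart_snd_mem hr.1)).cast
    (FlowBox.point_chart hr.1).symm (by rw [hsnd, FlowBox.point_chart hr.2.1])
  refine ⟨s.comp ρ hρt, s''.comp ρ hρt, hcomp s, hcomp s'', fun k => (η (ρ k)).trans (ζ k),
    fun k => (((η (ρ k)).map hc).trans ((ζ k).map hc)).toContinuousMap, γ.trans δ, ?_, ?_⟩
  · intro k r
    exact DFunLike.congr_fun (Path.map_trans (η (ρ k)) (ζ k) hc).symm r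
  · refine Path.tendsto_trans ((hγ.comp hρt).congr fun k => ?_) (hline.congr fun k => ?_)
    · exact ContinuousMap.ext fun r => hg (ρ k) r
    · exact ContinuousMap.ext fun r => (hζ k r).symm

theorem leaf_eq_chain [T2Space M] (hp : IsCoveringMap p) (e : GermUniversalCover p U hU) :
    e.leaf = (plaqueCover p U hU hp).chain e := by
  refine Subset.antisymm ?_ fun e' he' => ?_
  · rintro _ ⟨-, s, s', rfl, rfl, η, g, γ, hg, hγ⟩
    -- Evaluation at each time gives a convergent sequence, hence a curve of classes from `e` to the
    -- other endpoint.
    let σ : unitInterval → LConvergentSeq p := fun r => ⟨fun k => η k r, γ r, by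
      have := ((continuous_eval_const (F := C(unitInterval, M)) r).tendsto _).comp hγ
      exact this.congr fun k => hg k r⟩
    have h0 : (mk (σ 0) : GermUniversalCover p U hU) = mk s :=
      mk_eq_of_eventuallyEq γ.source (Eventually.of_forall fun k => (η k).source)
    have h1 : (mk (σ 1) : GermUniversalCover p U hU) = mk s' :=
      mk_eq_of_eventuallyEq γ.target (Eventually.of_forall fun k => (η k).target)
    rw [← h0, ← h1]
    refine PreconnectedSpace.induction₂'
      (fun r r' => (mk (σ r') : GermUniversalCover p U hU) ∈
        (plaqueCover p U hU hp).chain (mk (σ r))) (fun r => ?_)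
      ⟨fun _ _ _ h h' => PlaqueCover.chain_trans h h'⟩ 0 1
    let B : FlowBox n T M := convexBox (γ r)
    have hB : γ ⁻¹' B.carrier ∈ 𝓝 r :=
      γ.continuous.continuousAt (FlowBox.carrier_mem_nhds (mem_convexBox _))
    -- On a compact `K`, convergence in the compact-open topology keeps almost all paths inside the
    -- box throughout.
    obtain ⟨K, hK, hKsub, hKc⟩ := local_compact_nhds hB
    have : LocallyPathConnectedSpace unitInterval := (convex_Icc 0 1).locallyPathConnectedSpace
    obtain ⟨N, ⟨hN, hNc⟩, hNsub⟩ := (path_connected_basis r).mem_iff.1 hK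
    have hev := ContinuousMap.tendsto_nhds_compactOpen.1 hγ K hKc _ B.isOpen_carrier hKsub
    filter_upwards [hN] with r' hr'
    have hrel : Rel B (mk (σ r) : GermUniversalCover p U hU) (mk (σ r')) := by
      refine rel_mk_iff.2 ⟨mem_convexBox _, hKsub (hNsub hr'), ?_⟩
      filter_upwards [Ultrafilter.le_atTop_of_infinite hU hev] with k hk
      refine liftRel_of_isPreconnected hp (η k) hNc.isConnected.isPreconnected (fun q hq => ?_)
        (mem_of_mem_nhds hN) hr'
      rw [← hg]
      exact hk (hNsub hq)
    have := PlaqueCover.mem_chain_of_rel (c := plaqueCover p U hU hp) (y := γ r) hrel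
    exact ⟨this, PlaqueCover.chain_symm this⟩
  · induction he' with
    | refl => exact self_mem_leaf e
    | tail _ h ih =>
      obtain ⟨y, hy⟩ := h
      exact mem_leaf_of_rel hp (convex_convexBox y) ih hy

end GermUniversalCover

end GermLeaves

theorem mainTheorem11 {n : ℕ} {T : Type v} [TopologicalSpace T]
    {M : Type u} [TopologicalSpace M] [T2Space M] [FirstCountableTopology M]
    [ChartedSpace (EuclideanSpace ℝ (Fin n) × T) M] [IsLamination n T M]
    (hM : ∀ y : M, SecondCountableTopology (LeafSpace n T y))
    (x₀ : M) (hdense : Dense (leaf n T x₀))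
    {X : Type w} [TopologicalSpace X] [SimplyConnectedSpace X]
    (p : X → LeafSpace n T x₀) (hp : IsCoveringMap p)
    (haccum : (∀ P : Set M, IsPlaque n T P → P ⊆ leaf n T x₀ → ¬ IsOpen P) ∨
      {z : X | (p z).incl = x₀}.Infinite)
    (U : Ultrafilter ℕ) (hU : ∀ s ∈ U, s.Infinite) :
    ∃ (_ : TopologicalSpace (GermUniversalCover p U hU))
      (T' : Type (max u w)) (_ : TopologicalSpace T')
      (_ : ChartedSpace (EuclideanSpace ℝ (Fin n) × T') (GermUniversalCover p U hU)),
      IsLamination n T' (GermUniversalCover p U hU) ∧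
      (∀ e : GermUniversalCover p U hU, leaf n T' e = e.leaf) ∧
      (∀ e : GermUniversalCover p U hU, IsNowhereDense e.leaf) ∧
      IsLaminationMap n T' n T
        (GermUniversalCover.limProj : GermUniversalCover p U hU → M) ∧
      IsOpenMap (GermUniversalCover.limProj : GermUniversalCover p U hU → M) := by
  have hlam := (GermUniversalCover.plaqueCover p U hU hp).exists_lamination hM
    (GermUniversalCover.not_countable_fiber hp hdense haccum)
  simp only [← GermUniversalCover.leaf_eq_chain hp] at hlam
  exact hlam
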